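/- Let $d\in\mathbb N$. For $(m,n)\in\mathbb R^{d}\times\mathbb R^{d}=\mathbb R^{2d}$ let $T_{m,n}$ be the translation–modulation operator on $L^2(\mathbb R^d)$, $(T_{m,n}g)(x)=e^{2\pi i\,n\cdot x}g(x+m)$. For $v=(v^1,\dots,v^{2d})\in\mathbb R^{2d}$ let $Q_v=\frac{i}{2\pi}\nabla_v+f_v$, where $\nabla_v=\sum_{k=1}^d v^{k+d}\,\partial/\partial x^k$ is taken in the sense of tempered distributions and $f_v(x)=\sum_{k=1}^d v^kx^k$ acts by multiplication. For a tempered distribution $h$ on $\mathbb R^d$ let $\|h\|_2$ be its $L^2$ norm if $h\in L^2(\mathbb R^d)$, and $\|h\|_2=\infty$ otherwise. Let $\Omega((x,y),(\xi,\eta))=x\cdot\eta-y\cdot\xi$ be the standard symplectic form on $\mathbb R^{2d}$. Theorem. Let $\Lambda\subset\mathbb R^{2d}$ be countable with $\Lambda=-\Lambda$, let $g\in L^2(\mathbb R^d)$, and suppose that $\{T_{m,n}g:(m,n)\in\Lambda\}$ is an orthonormal basis of $L^2(\mathbb R^d)$. Then for all $v,w\in\mathbb R^{2d}$ with $\Omega(v,w)\neq0$,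 $$\|Q_v g\|_2\,\|Q_w g\|_2=\infty .$$ -/

import Mathlib

open MeasureTheory SchwartzMap LineDeriv
open scoped ENNReal

noncomputable section

namespace Gabor

/-- The space `ℝ^d`. -/
abbrev Space (d : ℕ) : Type := EuclideanSpace ℝ (Fin d)

/-- `ℝ^{2d}`, its points being written as pairs `(x, y)` with `x, y ∈ ℝ^d`: the first `d`
coordinates are those of `x`, the last `d` those of `y`. -/
abbrev Phase (d : ℕ) : Type := Space d × Space d

/-- The complex Hilbert space `L²(ℝ^d)`, for Lebesgue measure. -/
abbrev L2 (d : ℕ) : Type := Lp ℂ 2 (volume : Measure (Space d))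

/-- The standard symplectic form `Ω((x, y), (ξ, η)) = x · η - y · ξ` on `ℝ^{2d}`. -/
def symplecticForm {d : ℕ} (v w : Phase d) : ℝ :=
  (∑ k, v.1 k * w.2 k) - ∑ k, v.2 k * w.1 k

/-- The function `x ↦ e^{2πi n·x} g(x + m)`. -/
def transModFun {d : ℕ} (m n : Space d) (g : Space d → ℂ) : Space d → ℂ :=
  fun x => Complex.exp (2 * Real.pi * Complex.I * ((∑ k, n k * x k : ℝ) : ℂ)) * g (x + m)

theorem memLp_transModFun {d : ℕ} (m n : Space d) (g : L2 d) :
    MemLp (transModFun m n g) 2 (volume : Measure (Space d)) := by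
  have h : MemLp (fun x => g (x + m)) 2 (volume : Measure (Space d)) :=
    (Lp.memLp g).comp_measurePreserving (measurePreserving_add_right volume m)
  refine h.of_le (.mul ?_ h.1) (.of_forall fun x => ?_)
  · exact Continuous.aestronglyMeasurable (by fun_prop)
  · simp only [transModFun, norm_mul]
    rw [show (2 * Real.pi * Complex.I * ((∑ k, n k * x k : ℝ) : ℂ))
      = ((2 * Real.pi * ∑ k, n k * x k : ℝ) : ℂ) * Complex.I by push_cast; ring,
      Complex.norm_exp_ofReal_mul_I, one_mul]

/-- The translation-modulation transformation `T_{m,n}` on `L²(ℝ^d)`, indexed by the point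
`p = (m, n)` of `ℝ^{2d}`: `T_{m,n} g (x) = e^{2πi n·x} g(x + m)`. -/
def transMod {d : ℕ} (p : Phase d) (g : L2 d) : L2 d :=
  (memLp_transModFun p.1 p.2 g).toLp _

/-- `{T_{m,n} g : (m, n) ∈ Λ}` is an orthonormal basis of `L²(ℝ^d)`. -/
def IsGaborOrthonormalBasis {d : ℕ} (Λ : Set (Phase d)) (g : L2 d) : Prop :=
  ∃ b : HilbertBasis Λ ℂ (L2 d), ∀ p : Λ, b p = transMod (p : Phase d) g

/-- The linear function `f_v(x) = ∑ₖ vᵏ xᵏ` formed with the first `d` coordinates of `v`. -/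
def potential {d : ℕ} (v : Phase d) (x : Space d) : ℂ :=
  ((∑ k, v.1 k * x k : ℝ) : ℂ)

/-- So multiplication by `potential v` is a genuine operation on tempered distributions. -/
theorem hasTemperateGrowth_potential {d : ℕ} (v : Phase d) :
    (potential v).HasTemperateGrowth := by
  have h : potential v = fun x => (Complex.ofRealCLM ∘L
      ∑ k, v.1 k • (EuclideanSpace.proj k : Space d →L[ℝ] ℝ)) x := by
    funext x
    simp [potential]
  rw [h]
  exact ContinuousLinearMap.hasTemperateGrowth _

/-- The operator `Q_v = (i/2π) ∇_v + f_v` on tempered distributions, where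
`∇_v = ∑ₖ v^{k+d} ∂/∂xᵏ` is the (distributional) derivative in the direction formed by the
last `d` coordinates of `v`. -/
def Q {d : ℕ} (v : Phase d) (h : 𝓢'(Space d, ℂ)) : 𝓢'(Space d, ℂ) :=
  (Complex.I / (2 * Real.pi)) • ∂_{v.2} h + TemperedDistribution.smulLeftCLM ℂ (potential v) h

/-- The `L²` norm of a tempered distribution: `‖f‖₂` if it is given by an element `f` of `L²(ℝ^d)`
(which is then unique), and `∞` if it does not belong to `L²(ℝ^d)`. -/
def l2norm {d : ℕ} (h : 𝓢'(Space d, ℂ)) : ℝ≥0∞ :=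
  ⨅ (f : L2 d) (_ : (f : 𝓢'(Space d, ℂ)) = h), eLpNorm f 2 volume

end Gabor

end

/-!
Write `⟪·, ·⟫` for the inner product of `L²(ℝ^d)` and `tf p` for the translation-modulation
operator at `p ∈ ℝ^{2d}`. Suppose that `h = Q_v g` and `k = Q_w g` both lie in `L²(ℝ^d)`.

*Generators.* The operators `e^{-2πitQ_v}` are, up to phases, the translation-modulation operators
along a line of `ℝ^{2d}` (`flow`). Testing against smooth compactly supported functions shows that
the distributional equation `Q_v g = h` makes the orbit of `g` differentiable in norm
(`hasDerivAt_flow`). From there on `Q_v` is used only as the generator of this group (`HasGen`): it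
is symmetric, it commutes with `tf p` up to a real additive constant (`HasGen.map_tf`), and the
Weyl relation gives `2πi (⟪h, k⟫ - ⟪k, h⟫) = Ω(v, w) ‖g‖²` (`HasGen.commutator`). It remains to
show that `⟪h, k⟫` is real.

*An antisymmetric kernel.* For `p, q ∈ Λ` put `T p q = ⟪tf p h, tf q g⟫ ⟪tf q g, tf p k⟫`.
Parseval's identity says that each row of `T` sums to `⟪tf p h, tf p k⟫ = ⟪h, k⟫`. As the vectors
`tf p g` are orthogonal, the additive constants drop out of the matrix coefficients of `Q_v` and
`Q_w`, and the symmetry of these operators gives `T q p = conj (T p q)`. So `Im T` is antisymmetric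
with constant row sums `Im ⟪h, k⟫`. Averaging the rows with the weights `e^{-c‖p‖}` and letting
`c → 0` forces the constant to vanish (`eq_zero_of_antisymm_kernel`), provided that the weights are
summable and that the rows of `T` have uniformly small tails. When `0 ∈ Λ`, pairing `q` with `-q`
in the single row `p = 0` would do; but `0 ∉ Λ` is possible (already for a translated lattice), and
then the terms of one row need not cancel, only those of all the rows together.

*Separation and tails.* By orthogonality and continuity of `p ↦ ⟪tf p g, g⟫` the set `Λ` is
separated (`exists_sep_of_orthonormal`), which gives the summability of the weights. For the tails,
the matrix coefficients of the Gaussian are explicit, so that the Schur test bounds sums of their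
squares over separated sets; two approximations, first of `g` and then of `h` or `k` by
combinations of modulated Gaussians, transfer the decay (`tail_gauss`, `tail_orthonormal`).

Finally, `∞` times `0` is `0` in `ℝ≥0∞`, so it has to be known that neither factor vanishes: `Q_v`
has no kernel in `L²(ℝ^d)` for `v ≠ 0`, since a vector in the kernel has matrix coefficients of
constant modulus along a line, while these tend to zero (`eq_zero_of_Q_eq_zero`).
-/

noncomputable section

namespace Gabor

open Filter Topology
open scoped InnerProductSpace ComplexConjugate ContDiff

variable {d : ℕ}

/-! ### The character of the real line -/

/-- The character `t ↦ e^{2πit}` of the real line. -/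
def chi (t : ℝ) : ℂ := Complex.exp ((2 * Real.pi * t : ℝ) * Complex.I)

theorem norm_chi (t : ℝ) : ‖chi t‖ = 1 := Complex.norm_exp_ofReal_mul_I _

theorem chi_zero : chi 0 = 1 := by simp [chi]

theorem chi_add (s t : ℝ) : chi (s + t) = chi s * chi t := by
  rw [chi, chi, chi, ← Complex.exp_add]
  push_cast
  ring_nf

theorem conj_chi (t : ℝ) : conj (chi t) = chi (-t) := by
  rw [chi, chi, ← Complex.exp_conj, map_mul, Complex.conj_I, Complex.conj_ofReal]
  push_cast
  ring_nf

theorem chi_mul_chi_neg (t : ℝ) : chi t * chi (-t) = 1 := by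
  rw [← chi_add, add_neg_cancel, chi_zero]

theorem chi_neg_mul_chi (t : ℝ) : chi (-t) * chi t = 1 := by
  rw [mul_comm, chi_mul_chi_neg]

theorem contDiff_chi : ContDiff ℝ ∞ chi := by
  have h : ContDiff ℝ ∞ (fun t : ℝ => ((2 * Real.pi * t : ℝ) : ℂ)) :=
    Complex.ofRealCLM.contDiff.comp (contDiff_const.mul contDiff_id)
  exact (h.mul contDiff_const).cexp

@[fun_prop]
theorem continuous_chi : Continuous chi := contDiff_chi.continuous

theorem hasDerivAt_chi (t : ℝ) : HasDerivAt chi (2 * Real.pi * Complex.I * chi t) t := by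
  have h : HasDerivAt (fun t : ℝ => ((2 * Real.pi * t : ℝ) : ℂ) * Complex.I)
      ((2 * Real.pi : ℝ) * Complex.I) t := by
    have := (((hasDerivAt_id t).const_mul (2 * Real.pi)).ofReal_comp).mul_const Complex.I
    simpa using this
  refine h.cexp.congr_deriv ?_
  change chi t * _ = _
  push_cast
  ring

theorem sum_mul_eq_inner (x y : Space d) : ∑ k, x k * y k = ⟪x, y⟫_ℝ := by
  simp [PiLp.inner_apply, mul_comm]

/-! ### The translation-modulation operators -/

theorem transMod_ae (p : Phase d) (g : L2 d) :
    transMod p g =ᵐ[volume] fun x => chi ⟪p.2, x⟫_ℝ * g (x + p.1) := by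
  filter_upwards [(memLp_transModFun p.1 p.2 g).coeFn_toLp] with x hx
  rw [transMod, hx, transModFun, sum_mul_eq_inner, chi]
  push_cast
  ring_nf

theorem ae_add_right {P : Space d → Prop} (h : ∀ᵐ x, P x) (m : Space d) : ∀ᵐ x, P (x + m) :=
  (measurePreserving_add_right volume m).quasiMeasurePreserving.ae h

theorem transMod_add (p : Phase d) (f g : L2 d) :
    transMod p (f + g) = transMod p f + transMod p g := by
  apply Lp.ext
  filter_upwards [transMod_ae p (f + g), transMod_ae p f, transMod_ae p g,
    Lp.coeFn_add (transMod p f) (transMod p g),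
    ae_add_right (Lp.coeFn_add f g) p.1] with x h1 h2 h3 h4 h5
  rw [h1, h4, h5]
  simp only [Pi.add_apply]
  rw [h2, h3, mul_add]

theorem transMod_smul (p : Phase d) (c : ℂ) (g : L2 d) :
    transMod p (c • g) = c • transMod p g := by
  apply Lp.ext
  filter_upwards [transMod_ae p (c • g), transMod_ae p g, Lp.coeFn_smul c (transMod p g),
    ae_add_right (Lp.coeFn_smul c g) p.1] with x h1 h2 h3 h4
  rw [h1, h3, h4]
  simp only [Pi.smul_apply]
  rw [h2, smul_eq_mul, smul_eq_mul, mul_left_comm]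

theorem transMod_zero (g : L2 d) : transMod 0 g = g := by
  apply Lp.ext
  filter_upwards [transMod_ae 0 g] with x h1
  rw [h1]
  simp [chi_zero]

theorem norm_transMod (p : Phase d) (g : L2 d) : ‖transMod p g‖ = ‖g‖ := by
  rw [Lp.norm_def, Lp.norm_def, eLpNorm_congr_ae (transMod_ae p g)]
  congr 1
  rw [← eLpNorm_comp_measurePreserving (Lp.aestronglyMeasurable g)
    (measurePreserving_add_right volume p.1)]
  refine eLpNorm_congr_norm_ae (.of_forall fun x => ?_)
  simp [norm_chi]

/-- The translation-modulation operator as a linear isometry of `L²(ℝ^d)`. -/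
def tf (p : Phase d) : L2 d →ₗᵢ[ℂ] L2 d where
  toFun := transMod p
  map_add' := transMod_add p
  map_smul' := transMod_smul p
  norm_map' := norm_transMod p

theorem tf_apply (p : Phase d) (g : L2 d) : tf p g = transMod p g := rfl

theorem tf_zero (g : L2 d) : tf 0 g = g := transMod_zero g

theorem tf_ae (p : Phase d) (g : L2 d) :
    tf p g =ᵐ[volume] fun x => chi ⟪p.2, x⟫_ℝ * g (x + p.1) := transMod_ae p g

/-- The operators `tf p` form a projective representation of `ℝ^{2d}`. -/
theorem tf_tf (p q : Phase d) (g : L2 d) :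
    tf p (tf q g) = chi ⟪q.2, p.1⟫_ℝ • tf (p + q) g := by
  apply Lp.ext
  filter_upwards [tf_ae p (tf q g), tf_ae (p + q) g, ae_add_right (tf_ae q g) p.1,
    Lp.coeFn_smul (chi ⟪q.2, p.1⟫_ℝ) (tf (p + q) g)] with x h1 h2 h3 h4
  rw [h1, h3, h4, Pi.smul_apply, h2, smul_eq_mul, Prod.fst_add, Prod.snd_add, inner_add_left,
    inner_add_right, chi_add, chi_add, add_comm p.1 q.1, add_assoc x, add_comm p.1 q.1]
  ring

theorem tf_add (p q : Phase d) (g : L2 d) :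
    tf (p + q) g = chi (-⟪q.2, p.1⟫_ℝ) • tf p (tf q g) := by
  rw [tf_tf, smul_smul, chi_neg_mul_chi, one_smul]

theorem norm_inner_tf_add_tf (p q : Phase d) (f g : L2 d) :
    ‖⟪tf (p + q) f, tf q g⟫_ℂ‖ = ‖⟪tf p f, g⟫_ℂ‖ := by
  rw [add_comm, tf_add, inner_smul_left, (tf q).inner_map_map, norm_mul, RCLike.norm_conj,
    norm_chi, one_mul]

theorem tendsto_tf_translation (g : L2 d) :
    Tendsto (fun m : Space d => tf (m, 0) g) (𝓝 0) (𝓝 g) := by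
  have : Fact ((2 : ℝ≥0∞) ≠ ⊤) := ⟨by simp⟩
  have h : ∀ m : Space d, tf (m, 0) g = DomAddAct.mk m +ᵥ g := by
    intro m
    apply Lp.ext
    filter_upwards [tf_ae (m, 0) g, DomAddAct.vadd_Lp_ae_eq (DomAddAct.mk m) g] with x h1 h2
    rw [h1, h2]
    simp [chi_zero, add_comm]
  simp_rw [h]
  have hc : Continuous fun m : Space d => DomAddAct.mk m +ᵥ g := by
    have : Continuous fun m : Space d => DomAddAct.mk m := DomAddAct.continuous_mk
    exact this.vadd continuous_const
  simpa using hc.tendsto 0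

theorem integrable_conj_mul (f g : L2 d) : Integrable (fun x => conj (f x) * g x) :=
  (L2.integrable_inner f g).congr (.of_forall fun x => by simp [mul_comm])

theorem inner_eq_integral (f g : L2 d) : ⟪f, g⟫_ℂ = ∫ x, conj (f x) * g x := by
  rw [L2.inner_def]
  simp [mul_comm]

theorem tendsto_tf_modulation (g : L2 d) :
    Tendsto (fun n : Space d => tf (0, n) g) (𝓝 0) (𝓝 g) := by
  have h : ∀ n : Space d, ⟪g, tf (0, n) g⟫_ℂ = ∫ x, chi ⟪n, x⟫_ℝ * (conj (g x) * g x) := by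
    intro n
    rw [inner_eq_integral]
    refine integral_congr_ae ?_
    filter_upwards [tf_ae (0, n) g] with x hx
    rw [hx]
    simp only [add_zero]
    ring
  have hc : Continuous fun n : Space d => ⟪g, tf (0, n) g⟫_ℂ := by
    simp_rw [h]
    refine continuous_of_dominated (bound := fun x => ‖conj (g x) * g x‖) (fun n => ?_)
      (fun n => .of_forall fun x => ?_) (integrable_conj_mul g g).norm
      (.of_forall fun x => by fun_prop)
    · exact (Continuous.aestronglyMeasurable (by fun_prop)).mul
        (integrable_conj_mul g g).aestronglyMeasurable
    · rw [norm_mul, norm_chi, one_mul]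
  have hz : tf ((0, 0) : Phase d) g = g := tf_zero g
  have h2 : Tendsto (fun n : Space d => ‖tf (0, n) g - g‖ ^ 2) (𝓝 0) (𝓝 0) := by
    have : ∀ n : Space d, ‖tf (0, n) g - g‖ ^ 2
        = 2 * ‖g‖ ^ 2 - 2 * RCLike.re ⟪g, tf (0, n) g⟫_ℂ := by
      intro n
      rw [norm_sub_sq (𝕜 := ℂ), (tf _).norm_map, inner_re_symm]
      ring
    simp_rw [this]
    have h3 : Continuous fun n : Space d => 2 * ‖g‖ ^ 2 - 2 * RCLike.re ⟪g, tf (0, n) g⟫_ℂ := by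
      fun_prop
    convert h3.tendsto 0 using 2
    rw [hz, inner_self_eq_norm_sq]
    ring
  rw [tendsto_iff_norm_sub_tendsto_zero]
  convert h2.sqrt using 2 <;> simp

theorem continuous_tf (g : L2 d) : Continuous fun p : Phase d => tf p g := by
  -- By isometry, it is enough to treat the point `0`.
  have h0 : ∀ f : L2 d, Tendsto (fun p : Phase d => tf p f) (𝓝 0) (𝓝 f) := by
    intro f
    have hb : ∀ p : Phase d, ‖tf p f - f‖ ≤ ‖tf (p.1, 0) f - f‖ + ‖tf (0, p.2) f - f‖ := by
      intro p
      have : tf p f = tf (0, p.2) (tf (p.1, 0) f) := by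
        rw [tf_tf]
        simp [chi_zero]
      rw [this, ← (tf (0, p.2)).norm_map (tf (p.1, 0) f - f), map_sub]
      exact norm_sub_le_norm_sub_add_norm_sub _ _ _
    have h1 := ((tendsto_tf_translation f).comp
      (continuous_fst.tendsto (0 : Phase d)))
    have h2 := ((tendsto_tf_modulation f).comp
      (continuous_snd.tendsto (0 : Phase d)))
    rw [tendsto_iff_norm_sub_tendsto_zero] at h1 h2 ⊢
    exact squeeze_zero (fun _ => norm_nonneg _) hb (by simpa using h1.add h2)
  rw [continuous_iff_continuousAt]
  intro p
  have h1 : Tendsto (fun q : Phase d => chi (-⟪p.2, q.1⟫_ℝ) • tf q (tf p g)) (𝓝 0)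
      (𝓝 ((1 : ℂ) • tf p g)) := by
    refine Tendsto.smul ?_ (h0 _)
    have : Continuous fun q : Phase d => chi (-⟪p.2, q.1⟫_ℝ) := by fun_prop
    simpa [chi_zero] using this.tendsto 0
  have h2 : Tendsto (fun q : Phase d => q - p) (𝓝 p) (𝓝 0) := by
    simpa using (continuous_id.sub continuous_const).tendsto (x := p) (f := fun q => q - p)
  have h3 := h1.comp h2
  rw [one_smul] at h3
  refine h3.congr fun q => ?_
  rw [Function.comp, ← tf_add, sub_add_cancel]

/-! ### The one-parameter groups generated by the operators `Q v` -/

/-- The unitary operator `e^{-2πitQ_v}`: the translation-modulation operator at the point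
`(t v², -t v¹)`, with the phase that makes it a one-parameter group. -/
def flow (v : Phase d) (t : ℝ) (f : L2 d) : L2 d :=
  chi (-(t ^ 2 / 2 * ⟪v.1, v.2⟫_ℝ)) • tf (t • v.2, -(t • v.1)) f

theorem flow_zero (v : Phase d) (f : L2 d) : flow v 0 f = f := by
  have : tf ((0, 0) : Phase d) f = f := tf_zero f
  simp [flow, chi_zero, this]

theorem flow_flow (v : Phase d) (s t : ℝ) (f : L2 d) :
    flow v s (flow v t f) = flow v (s + t) f := by
  rw [flow, flow, flow, map_smul, tf_tf, smul_smul, smul_smul, ← chi_add, ← chi_add]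
  congr 2
  · simp only [inner_neg_left, inner_smul_left, inner_smul_right, RCLike.conj_to_real]
    ring
  · simp [add_smul, add_comm]

theorem inner_flow_flow (v : Phase d) (t : ℝ) (f g : L2 d) :
    ⟪flow v t f, flow v t g⟫_ℂ = ⟪f, g⟫_ℂ := by
  rw [flow, flow, inner_smul_left, inner_smul_right, (tf _).inner_map_map, conj_chi, ← mul_assoc,
    chi_neg_mul_chi, one_mul]

theorem inner_flow_right (v : Phase d) (t : ℝ) (f g : L2 d) :
    ⟪f, flow v t g⟫_ℂ = ⟪flow v (-t) f, g⟫_ℂ := by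
  rw [← inner_flow_flow v (-t) f, flow_flow, neg_add_cancel, flow_zero]

theorem flow_tf (v p : Phase d) (t : ℝ) (f : L2 d) :
    flow v t (tf p f) = chi (t * (⟪p.2, v.2⟫_ℝ + ⟪v.1, p.1⟫_ℝ)) • tf p (flow v t f) := by
  rw [flow, flow, map_smul, tf_tf, tf_tf, smul_smul, smul_smul, smul_smul, ← chi_add, ← chi_add,
    ← chi_add, add_comm p]
  congr 2
  simp only [inner_neg_left, inner_smul_left, inner_smul_right, RCLike.conj_to_real]
  ring

theorem flow_flow_comm (v w : Phase d) (s t : ℝ) (f : L2 d) :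
    flow v t (flow w s f) = chi (t * s * symplecticForm v w) • flow w s (flow v t f) := by
  conv_lhs => rw [flow.eq_def w]
  conv_rhs => rw [flow.eq_def w]
  have hs : flow v t (chi (-(s ^ 2 / 2 * ⟪w.1, w.2⟫_ℝ)) • tf (s • w.2, -(s • w.1)) f)
      = chi (-(s ^ 2 / 2 * ⟪w.1, w.2⟫_ℝ)) • flow v t (tf (s • w.2, -(s • w.1)) f) := by
    rw [flow, flow, map_smul, smul_comm]
  rw [hs, flow_tf, smul_smul, smul_smul, ← chi_add, ← chi_add, symplecticForm, sum_mul_eq_inner,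
    sum_mul_eq_inner]
  congr 2
  simp only [inner_neg_right, inner_smul_right, real_inner_comm v.2]
  ring

theorem continuous_flow (v : Phase d) (f : L2 d) : Continuous fun t => flow v t f := by
  refine Continuous.smul (continuous_chi.comp (by fun_prop))
    ((continuous_tf f).comp (g := fun p => tf p f) (f := fun t : ℝ => (t • v.2, -(t • v.1))) ?_)
  fun_prop

theorem flow_ae (v : Phase d) (t : ℝ) (f : L2 d) :
    flow v t f =ᵐ[volume] fun x =>
      chi (-(t ^ 2 / 2 * ⟪v.1, v.2⟫_ℝ) - t * ⟪v.1, x⟫_ℝ) * f (x + t • v.2) := by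
  filter_upwards [tf_ae (t • v.2, -(t • v.1)) f, Lp.coeFn_smul (chi (-(t ^ 2 / 2 * ⟪v.1, v.2⟫_ℝ)))
    (tf (t • v.2, -(t • v.1)) f)] with x h1 h2
  rw [flow, h2, Pi.smul_apply, h1, smul_eq_mul, ← mul_assoc, ← chi_add]
  simp [inner_smul_left, sub_eq_add_neg]

/-! ### From the distribution `Q v g` to the derivative of the flow -/

/-- The equation `Q v g = h` tested against a smooth compactly supported function. -/
theorem integral_mul_of_eq_Q {v : Phase d} {g h : L2 d}
    (hQ : (h : 𝓢'(Space d, ℂ)) = Q v (g : 𝓢'(Space d, ℂ))) {φ : Space d → ℂ}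
    (hφ : ContDiff ℝ ∞ φ) (hc : HasCompactSupport φ) :
    ∫ x, φ x * h x = Complex.I / (2 * Real.pi) * (∫ x, -(lineDeriv ℝ φ x v.2) * g x)
      + ∫ x, (⟪v.1, x⟫_ℝ * φ x) * g x := by
  have h1 := congrArg (fun T : 𝓢'(Space d, ℂ) => T (hc.toSchwartzMap hφ)) hQ
  simp only [Q, Lp.toTemperedDistribution_apply] at h1
  have h2 : ((Complex.I / (2 * Real.pi)) • ∂_{v.2} (g : 𝓢'(Space d, ℂ))
      + TemperedDistribution.smulLeftCLM ℂ (potential v) (g : 𝓢'(Space d, ℂ)))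
        (hc.toSchwartzMap hφ)
      = Complex.I / (2 * Real.pi) * ((g : 𝓢'(Space d, ℂ)) (-∂_{v.2} (hc.toSchwartzMap hφ)))
        + (g : 𝓢'(Space d, ℂ)) (SchwartzMap.smulLeftCLM ℂ (potential v) (hc.toSchwartzMap hφ)) :=
    rfl
  rw [h2, Lp.toTemperedDistribution_apply, Lp.toTemperedDistribution_apply] at h1
  refine h1.trans (congrArg₂ _ (congrArg _ (integral_congr_ae (.of_forall fun x => ?_)))
    (integral_congr_ae (.of_forall fun x => ?_)))
  · change (-(∂_{v.2} (hc.toSchwartzMap hφ) x)) • g x = _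
    rw [SchwartzMap.lineDerivOp_apply]
    rfl
  · beta_reduce
    rw [SchwartzMap.smulLeftCLM_apply_apply (hasTemperateGrowth_potential v), potential,
      sum_mul_eq_inner]
    rfl

/-- The transpose of `flow v t`, for the bilinear pairing, on a test function. -/
def dualFlow (v : Phase d) (φ : Space d → ℝ) (t : ℝ) (y : Space d) : ℂ :=
  φ (y - t • v.2) * chi (t ^ 2 / 2 * ⟪v.1, v.2⟫_ℝ - t * ⟪v.1, y⟫_ℝ)

/-- The derivative of `dualFlow v φ t y` in `t`. -/
def dualFlowDeriv (v : Phase d) (φ : Space d → ℝ) (t : ℝ) (y : Space d) : ℂ :=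
  (-(fderiv ℝ φ (y - t • v.2) v.2 : ℂ) + 2 * Real.pi * Complex.I *
    (t * ⟪v.1, v.2⟫_ℝ - ⟪v.1, y⟫_ℝ : ℝ) * φ (y - t • v.2)) *
    chi (t ^ 2 / 2 * ⟪v.1, v.2⟫_ℝ - t * ⟪v.1, y⟫_ℝ)

variable {φ : Space d → ℝ}

theorem contDiff_dualFlow (v : Phase d) (hφ : ContDiff ℝ ∞ φ) (t : ℝ) :
    ContDiff ℝ ∞ (dualFlow v φ t) := by
  have h1 : ContDiff ℝ ∞ fun y : Space d => φ (y - t • v.2) := by fun_prop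
  exact (Complex.ofRealCLM.contDiff.comp h1).mul (contDiff_chi.comp
    (contDiff_const.sub (contDiff_const.mul (contDiff_const.inner ℝ contDiff_id))))

theorem hasCompactSupport_dualFlow (v : Phase d) (hc : HasCompactSupport φ) (t : ℝ) :
    HasCompactSupport (dualFlow v φ t) := by
  have h1 : HasCompactSupport fun y : Space d => φ (y - t • v.2) := by
    simpa [sub_eq_add_neg] using! hc.comp_homeomorph (Homeomorph.addRight (-(t • v.2)))
  have h2 : HasCompactSupport fun y : Space d => (φ (y - t • v.2) : ℂ) :=
    h1.comp_left (g := Complex.ofReal) Complex.ofReal_zero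
  exact h2.mul_right

theorem hasDerivAt_dualFlow (v : Phase d) (hφ : ContDiff ℝ ∞ φ) (t : ℝ) (y : Space d) :
    HasDerivAt (fun t => dualFlow v φ t y) (dualFlowDeriv v φ t y) t := by
  have h1 : HasDerivAt (fun t : ℝ => y - t • v.2) (-v.2) t := by
    simpa using ((hasDerivAt_id t).smul_const v.2).const_sub y
  have h2 := (((hφ.differentiable (by simp)) (y - t • v.2)).hasFDerivAt.comp_hasDerivAt t
    h1).ofReal_comp
  have h3 : HasDerivAt (fun t : ℝ => t ^ 2 / 2 * ⟪v.1, v.2⟫_ℝ - t * ⟪v.1, y⟫_ℝ)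
      (t * ⟪v.1, v.2⟫_ℝ - ⟪v.1, y⟫_ℝ) t := by
    have := (((hasDerivAt_pow 2 t).div_const 2).mul_const ⟪v.1, v.2⟫_ℝ).sub
      ((hasDerivAt_id t).mul_const ⟪v.1, y⟫_ℝ)
    refine (this.congr_deriv ?_).congr_of_eventuallyEq (.of_forall fun s => ?_)
    · simp
    · simp
  refine (h2.mul ((hasDerivAt_chi _).scomp t h3)).congr_deriv ?_
  simp only [dualFlowDeriv, map_neg, Function.comp, Complex.real_smul]
  push_cast
  ring

theorem lineDeriv_dualFlow (v : Phase d) (hφ : ContDiff ℝ ∞ φ) (t : ℝ) (y : Space d) :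
    lineDeriv ℝ (dualFlow v φ t) y v.2 = (fderiv ℝ φ (y - t • v.2) v.2
      - 2 * Real.pi * Complex.I * (t * ⟪v.1, v.2⟫_ℝ : ℝ) * φ (y - t • v.2)) *
      chi (t ^ 2 / 2 * ⟪v.1, v.2⟫_ℝ - t * ⟪v.1, y⟫_ℝ) := by
  refine HasLineDerivAt.lineDeriv ?_
  have h1 : HasDerivAt (fun s : ℝ => y + s • v.2 - t • v.2) v.2 0 := by
    simpa using (((hasDerivAt_id (0 : ℝ)).smul_const v.2).const_add y).sub_const (t • v.2)
  have h2 := (((hφ.differentiable (by simp))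
    (y + (0 : ℝ) • v.2 - t • v.2)).hasFDerivAt.comp_hasDerivAt (0 : ℝ) h1).ofReal_comp
  have h3 : HasDerivAt (fun s : ℝ => t ^ 2 / 2 * ⟪v.1, v.2⟫_ℝ - t * ⟪v.1, y + s • v.2⟫_ℝ)
      (-(t * ⟪v.1, v.2⟫_ℝ)) 0 := by
    have : (fun s : ℝ => t ^ 2 / 2 * ⟪v.1, v.2⟫_ℝ - t * ⟪v.1, y + s • v.2⟫_ℝ)
        = fun s : ℝ => (t ^ 2 / 2 * ⟪v.1, v.2⟫_ℝ - t * ⟪v.1, y⟫_ℝ) - s * (t * ⟪v.1, v.2⟫_ℝ) := by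
      funext s
      rw [inner_add_right, inner_smul_right]
      ring
    rw [this]
    simpa using ((hasDerivAt_id (0 : ℝ)).mul_const (t * ⟪v.1, v.2⟫_ℝ)).const_sub
      (t ^ 2 / 2 * ⟪v.1, v.2⟫_ℝ - t * ⟪v.1, y⟫_ℝ)
  refine (h2.mul ((hasDerivAt_chi _).scomp (0 : ℝ) h3)).congr_deriv ?_
  simp only [Function.comp, Complex.real_smul, zero_smul, add_zero]
  push_cast
  ring

theorem integral_mul_flow (v : Phase d) (φ : Space d → ℝ) (t : ℝ) (f : L2 d) :
    ∫ x, (φ x : ℂ) * flow v t f x = ∫ y, dualFlow v φ t y * f y := by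
  rw [← integral_add_right_eq_self (fun y => dualFlow v φ t y * f y) (t • v.2)]
  refine integral_congr_ae ?_
  filter_upwards [flow_ae v t f] with x hx
  rw [hx, dualFlow, add_sub_cancel_right, inner_add_right, inner_smul_right, mul_assoc]
  congr 3
  ring

theorem continuous_dualFlowDeriv (v : Phase d) (hφ : ContDiff ℝ ∞ φ) :
    Continuous fun q : ℝ × Space d => dualFlowDeriv v φ q.1 q.2 := by
  have h1 : Continuous fun q : ℝ × Space d => fderiv ℝ φ (q.2 - q.1 • v.2) v.2 :=
    ((hφ.continuous_fderiv (by simp)).comp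
      (g := fderiv ℝ φ) (f := fun q : ℝ × Space d => q.2 - q.1 • v.2) (by fun_prop)).clm_apply
      continuous_const
  have h2 := hφ.continuous
  unfold dualFlowDeriv
  fun_prop

theorem hasDerivAt_integral_dualFlow (v : Phase d) (hφ : ContDiff ℝ ∞ φ)
    (hc : HasCompactSupport φ) (g : L2 d) (t₀ : ℝ) :
    HasDerivAt (fun t => ∫ y, dualFlow v φ t y * g y) (∫ y, dualFlowDeriv v φ t₀ y * g y) t₀ := by
  have hg : LocallyIntegrable g := (Lp.memLp g).locallyIntegrable (by norm_num)
  -- All the functions of `y` vanish off a compact set as long as `t` stays close to `t₀`.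
  obtain ⟨K, hK, hKφ⟩ : ∃ K : Set (Space d), IsCompact K ∧
      ∀ t ∈ Set.Icc (t₀ - 1) (t₀ + 1), ∀ x ∈ tsupport φ, x + t • v.2 ∈ K :=
    ⟨(fun q : ℝ × Space d => q.2 + q.1 • v.2) '' (Set.Icc (t₀ - 1) (t₀ + 1) ×ˢ tsupport φ),
      (isCompact_Icc.prod hc).image (by fun_prop), fun t ht x hx => ⟨(t, x), ⟨ht, hx⟩, rfl⟩⟩
  obtain ⟨C, hC⟩ := (isCompact_Icc.prod hK).exists_bound_of_continuousOn
    (s := Set.Icc (t₀ - 1) (t₀ + 1) ×ˢ K) (continuous_dualFlowDeriv v hφ).continuousOn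
  have hint : ∀ t, Integrable fun y => dualFlow v φ t y * g y := fun t => by
    simpa using! hg.integrable_smul_left_of_hasCompactSupport
      (contDiff_dualFlow v hφ t).continuous (hasCompactSupport_dualFlow v hc t)
  refine (hasDerivAt_integral_of_dominated_loc_of_deriv_le (F := fun t y => dualFlow v φ t y * g y)
    (F' := fun t y => dualFlowDeriv v φ t y * g y)
    (bound := K.indicator fun y => C * ‖g y‖) (s := Set.Icc (t₀ - 1) (t₀ + 1))
    (Icc_mem_nhds (by linarith) (by linarith))
    (.of_forall fun t => (hint t).aestronglyMeasurable) (hint t₀) ?_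
    (.of_forall fun y t ht => ?_) ?_ (.of_forall fun y t _ =>
      (hasDerivAt_dualFlow v hφ t y).mul_const _)).2
  · have h1 : Continuous fun y => dualFlowDeriv v φ t₀ y :=
      (continuous_dualFlowDeriv v hφ).comp (g := fun q : ℝ × Space d => dualFlowDeriv v φ q.1 q.2)
        (f := fun y => (t₀, y)) (by fun_prop)
    exact h1.aestronglyMeasurable.mul (Lp.aestronglyMeasurable g)
  · change ‖dualFlowDeriv v φ t y * g y‖ ≤ K.indicator (fun y => C * ‖g y‖) y
    by_cases hy : y ∈ K
    · rw [Set.indicator_of_mem hy]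
      exact (norm_mul_le _ _).trans (mul_le_mul_of_nonneg_right (hC (t, y) ⟨ht, hy⟩)
        (norm_nonneg _))
    · have h1 : y - t • v.2 ∉ tsupport φ := fun h => hy (by simpa using hKφ t ht _ h)
      have h2 : φ (y - t • v.2) = 0 := image_eq_zero_of_notMem_tsupport h1
      have h3 : fderiv ℝ φ (y - t • v.2) = 0 := by
        by_contra h
        exact h1 (support_fderiv_subset ℝ h)
      simp [Set.indicator_of_notMem hy, dualFlowDeriv, h2, h3]
  · rw [integrable_indicator_iff hK.measurableSet]
    exact (hg.integrableOn_isCompact hK).norm.const_mul C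

theorem hasDerivAt_integral_mul_flow {v : Phase d} {g h : L2 d}
    (hQ : (h : 𝓢'(Space d, ℂ)) = Q v (g : 𝓢'(Space d, ℂ))) (hφ : ContDiff ℝ ∞ φ)
    (hc : HasCompactSupport φ) (t : ℝ) :
    HasDerivAt (fun t => ∫ x, (φ x : ℂ) * flow v t g x)
      (-(2 * Real.pi * Complex.I) * ∫ x, (φ x : ℂ) * flow v t h x) t := by
  simp_rw [integral_mul_flow]
  refine (hasDerivAt_integral_dualFlow v hφ hc g t).congr_deriv ?_
  have hg : LocallyIntegrable g := (Lp.memLp g).locallyIntegrable (by norm_num)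
  have hψ := contDiff_dualFlow v hφ t
  have hψc := hasCompactSupport_dualFlow v hc t
  have hI : -(2 * Real.pi * Complex.I) * (Complex.I / (2 * Real.pi)) = 1 := by
    have : (Real.pi : ℂ) ≠ 0 := by simp [Real.pi_ne_zero]
    field_simp
    simp
  have hd : (fun y => lineDeriv ℝ (dualFlow v φ t) y v.2)
      = fun y => fderiv ℝ (dualFlow v φ t) y v.2 := by
    funext y
    exact ((hψ.differentiable (by simp)) y).lineDeriv_eq_fderiv
  have hd1 : Continuous fun y => lineDeriv ℝ (dualFlow v φ t) y v.2 := by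
    rw [hd]
    exact (hψ.continuous_fderiv (by simp)).clm_apply continuous_const
  have hd2 : HasCompactSupport fun y => lineDeriv ℝ (dualFlow v φ t) y v.2 := by
    rw [hd]
    exact hψc.fderiv_apply ℝ v.2
  rw [integral_mul_of_eq_Q hQ hψ hψc, mul_add, ← mul_assoc, hI, one_mul, ← integral_const_mul,
    ← integral_add]
  · congr 1
    ext y
    rw [lineDeriv_dualFlow v hφ, dualFlowDeriv, dualFlow]
    push_cast
    ring
  · simpa using! hg.integrable_smul_left_of_hasCompactSupport hd1.neg hd2.neg
  · refine Integrable.const_mul ?_ _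
    have h1 : Continuous fun y => (⟪v.1, y⟫_ℝ : ℂ) * dualFlow v φ t y := by
      have := hψ.continuous
      fun_prop
    simpa using! hg.integrable_smul_left_of_hasCompactSupport h1 hψc.mul_left

/-- If `Q v g` is the square integrable function `h`, then `t ↦ e^{-2πitQ_v} g` is differentiable
in `L²(ℝ^d)`, with derivative `-2πi e^{-2πitQ_v} h`. -/
theorem hasDerivAt_flow {v : Phase d} {g h : L2 d}
    (hQ : (h : 𝓢'(Space d, ℂ)) = Q v (g : 𝓢'(Space d, ℂ))) (t : ℝ) :
    HasDerivAt (fun t => flow v t g) (-(2 * Real.pi * Complex.I) • flow v t h) t := by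
  have hcont : Continuous fun s => -(2 * Real.pi * Complex.I) • flow v s h :=
    (continuous_flow v h).const_smul (-(2 * Real.pi * Complex.I))
  have hI : ∀ t, HasDerivAt (fun t => ∫ s in (0 : ℝ)..t, -(2 * Real.pi * Complex.I) • flow v s h)
      (-(2 * Real.pi * Complex.I) • flow v t h) t := fun t =>
    intervalIntegral.integral_hasDerivAt_right (hcont.intervalIntegrable _ _)
      (hcont.stronglyMeasurableAtFilter _ _) hcont.continuousAt
  -- The difference of the two sides of the integrated equation.
  let k : ℝ → L2 d := fun t =>
    flow v t g - g - ∫ s in (0 : ℝ)..t, -(2 * Real.pi * Complex.I) • flow v s h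
  have hk : ∀ t, k t = 0 := by
    intro t
    rw [Lp.eq_zero_iff_ae_eq_zero]
    refine ae_eq_zero_of_integral_contDiff_smul_eq_zero
      ((Lp.memLp (k t)).locallyIntegrable (by norm_num)) fun φ hφ hc => ?_
    have hφL : MemLp (fun x => (φ x : ℂ)) 2 (volume : Measure (Space d)) :=
      (Complex.continuous_ofReal.comp hφ.continuous).memLp_of_hasCompactSupport
        (hc.comp_left (g := Complex.ofReal) Complex.ofReal_zero)
    have hpair : ∀ f : L2 d, ⟪hφL.toLp, f⟫_ℂ = ∫ x, (φ x : ℂ) * f x := by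
      intro f
      rw [inner_eq_integral]
      refine integral_congr_ae ?_
      filter_upwards [hφL.coeFn_toLp] with x hx
      rw [hx, Complex.conj_ofReal]
    have hd : ∀ t, HasDerivAt (fun t => ⟪hφL.toLp, k t⟫_ℂ) 0 t := by
      intro t
      have h1 := hasDerivAt_integral_mul_flow hQ hφ hc t
      simp_rw [← hpair] at h1
      have h2 := (hasDerivAt_const t hφL.toLp).inner ℂ (hI t)
      refine (((h1.sub_const ⟪hφL.toLp, g⟫_ℂ).sub h2).congr_deriv ?_).congr_of_eventuallyEq
        (.of_forall fun t => ?_)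
      · simp [inner_smul_right]
      · simp only [k, inner_sub_right, Pi.sub_apply]
    have hz : ⟪hφL.toLp, k t⟫_ℂ = 0 := by
      rw [is_const_of_deriv_eq_zero (fun t => (hd t).differentiableAt) (fun t => (hd t).deriv) t 0]
      simp [k, flow_zero]
    rw [hpair] at hz
    simpa using! hz
  have hflow : (fun t => flow v t g)
      = fun t => g + ∫ s in (0 : ℝ)..t, -(2 * Real.pi * Complex.I) • flow v s h := by
    funext t
    have := hk t
    simp only [k, sub_sub, sub_eq_zero] at this
    exact this
  rw [hflow]
  exact (hI t).const_add g

/-! ### The operators `Q v` as generators -/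

/-- `HasGen v a A` says that `a` lies in the domain of the generator `Q_v` of the one-parameter
group `flow v`, and that `Q_v a = A`. -/
def HasGen (v : Phase d) (a A : L2 d) : Prop :=
  HasDerivAt (fun t => flow v t a) (-(2 * Real.pi * Complex.I) • A) 0

theorem hasGen_of_eq_Q {v : Phase d} {g h : L2 d}
    (hQ : (h : 𝓢'(Space d, ℂ)) = Q v (g : 𝓢'(Space d, ℂ))) : HasGen v g h := by
  simpa [HasGen, flow_zero] using hasDerivAt_flow hQ 0

theorem HasGen.neg_time {v : Phase d} {a A : L2 d} (h : HasGen v a A) :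
    HasDerivAt (fun t => flow v (-t) a) ((2 * Real.pi * Complex.I) • A) 0 := by
  have h1 : HasDerivAt (fun t => flow v t a) (-(2 * Real.pi * Complex.I) • A) (-0 : ℝ) := by
    rw [neg_zero]
    exact h
  simpa [Function.comp_def] using h1.scomp (0 : ℝ) (hasDerivAt_neg (0 : ℝ))

theorem conj_two_pi_I : conj (2 * Real.pi * Complex.I : ℂ) = -(2 * Real.pi * Complex.I) := by
  rw [map_mul, map_mul, Complex.conj_I, Complex.conj_ofReal, map_ofNat, mul_neg]

/-- `Q_v` is symmetric. -/
theorem HasGen.inner_symm {v : Phase d} {a A b B : L2 d} (ha : HasGen v a A)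
    (hb : HasGen v b B) : ⟪b, A⟫_ℂ = ⟪B, a⟫_ℂ := by
  have h1 := (hasDerivAt_const (0 : ℝ) b).inner ℂ ha
  have h2 := hb.neg_time.inner ℂ (hasDerivAt_const (0 : ℝ) a)
  have h3 := (h1.congr_of_eventuallyEq (.of_forall fun t => (inner_flow_right v t b a).symm)).unique
    h2
  rw [inner_zero_left, inner_zero_right, add_zero, zero_add, inner_smul_left,
    inner_smul_right, conj_two_pi_I] at h3
  exact mul_left_cancel₀ (neg_ne_zero.mpr Complex.two_pi_I_ne_zero) h3

/-- Translation-modulation operators commute with `Q_v` up to a real additive constant. -/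
theorem HasGen.map_tf {v : Phase d} {a A : L2 d} (ha : HasGen v a A) (p : Phase d) :
    HasGen v (tf p a) (tf p A - ((⟪p.2, v.2⟫_ℝ + ⟪v.1, p.1⟫_ℝ : ℝ) : ℂ) • tf p a) := by
  unfold HasGen
  simp_rw [flow_tf]
  set κ := ⟪p.2, v.2⟫_ℝ + ⟪v.1, p.1⟫_ℝ
  have h1 : HasDerivAt (fun t : ℝ => chi (t * κ)) (κ • (2 * Real.pi * Complex.I * chi (0 * κ))) 0 :=
    (hasDerivAt_chi _).scomp (0 : ℝ) (by simpa using (hasDerivAt_id (0 : ℝ)).mul_const κ)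
  have h2 : HasDerivAt (fun t : ℝ => tf p (flow v t a))
      (tf p (-(2 * Real.pi * Complex.I) • A)) 0 :=
    ((tf p).toContinuousLinearMap.restrictScalars ℝ).hasFDerivAt.comp_hasDerivAt (0 : ℝ) ha
  refine (h1.smul h2).congr_deriv ?_
  simp only [zero_mul, chi_zero, flow_zero, map_smul, mul_one, Complex.real_smul]
  module

theorem HasGen.inner_tf_symm {v : Phase d} {a A : L2 d} (ha : HasGen v a A) {p q : Phase d}
    (hpq : p = q ∨ ⟪tf p a, tf q a⟫_ℂ = 0) :
    ⟪tf p a, tf q A⟫_ℂ = ⟪tf p A, tf q a⟫_ℂ := by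
  have h := (ha.map_tf q).inner_symm (ha.map_tf p)
  rw [inner_sub_right, inner_sub_left, inner_smul_left, inner_smul_right, Complex.conj_ofReal] at h
  rcases hpq with rfl | hpq
  · exact sub_left_injective h
  · simpa [hpq] using h

/-- The canonical commutation relation `[Q_v, Q_w] = Ω(v, w) / (2πi)`, in the weak sense. -/
theorem HasGen.commutator {v w : Phase d} {g h k : L2 d} (hv : HasGen v g h)
    (hw : HasGen w g k) :
    2 * Real.pi * Complex.I * (⟪h, k⟫_ℂ - ⟪k, h⟫_ℂ) = symplecticForm v w * (‖g‖ : ℂ) ^ 2 := by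
  have hslope : ∀ {F : ℝ → L2 d} {F' : L2 d}, HasDerivAt F F' 0 → F 0 = g →
      Tendsto (fun t : ℝ => ((t⁻¹ : ℝ) : ℂ) • (F t - g)) (𝓝[≠] 0) (𝓝 F') := by
    intro F F' hF h0
    have := hasDerivAt_iff_tendsto_slope_zero.mp hF
    simp only [zero_add, h0, RCLike.real_smul_eq_coe_smul (K := ℂ)] at this
    exact this
  have h1 := hslope hv (flow_zero v g)
  have h2 := hslope hw (flow_zero w g)
  have h3 := hslope hv.neg_time (by simp [flow_zero])
  have h4 := hslope hw.neg_time (by simp [flow_zero])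
  have hl := (h3.inner h2 (𝕜 := ℂ)).sub (h4.inner h1 (𝕜 := ℂ))
  -- The second mixed difference of the Weyl relation.
  have hweyl : ∀ t : ℝ,
      ⟪flow v (-t) g - g, flow w t g - g⟫_ℂ - ⟪flow w (-t) g - g, flow v t g - g⟫_ℂ
      = (chi (t * t * symplecticForm v w) - 1) * ⟪flow w (-t) g, flow v t g⟫_ℂ := by
    intro t
    have e1 : ⟪flow v (-t) g, flow w t g⟫_ℂ
        = chi (t * t * symplecticForm v w) * ⟪flow w (-t) g, flow v t g⟫_ℂ := by
      rw [← inner_flow_right, flow_flow_comm, inner_smul_right, inner_flow_right w]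
    have e2 : ⟪flow v (-t) g, g⟫_ℂ = ⟪g, flow v t g⟫_ℂ := (inner_flow_right v t g g).symm
    have e3 : ⟪flow w (-t) g, g⟫_ℂ = ⟪g, flow w t g⟫_ℂ := (inner_flow_right w t g g).symm
    simp only [inner_sub_left, inner_sub_right]
    rw [e1, e2, e3]
    ring
  have hchi : Tendsto (fun t : ℝ => (((t * t)⁻¹ : ℝ) : ℂ) * (chi (t * t * symplecticForm v w) - 1))
      (𝓝[≠] 0) (𝓝 (symplecticForm v w * (2 * Real.pi * Complex.I))) := by
    have hd : HasDerivAt (fun u : ℝ => chi (u * symplecticForm v w))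
        (symplecticForm v w • (2 * Real.pi * Complex.I * chi (0 * symplecticForm v w))) 0 :=
      (hasDerivAt_chi _).scomp (0 : ℝ) (by simpa using (hasDerivAt_id (0 : ℝ)).mul_const _)
    have hs := hasDerivAt_iff_tendsto_slope_zero.mp hd
    have hsq : Tendsto (fun t : ℝ => t * t) (𝓝[≠] 0) (𝓝[≠] 0) := by
      refine tendsto_nhdsWithin_iff.mpr ⟨?_, ?_⟩
      · exact ((continuous_id.mul continuous_id).tendsto' (0 : ℝ) 0 (by simp)).mono_left
          nhdsWithin_le_nhds
      · filter_upwards [self_mem_nhdsWithin] with t ht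
        exact mul_ne_zero ht ht
    have := hs.comp hsq
    simpa only [Function.comp_def, zero_add, zero_mul, chi_zero, mul_one, Complex.real_smul]
      using this
  have hin : Tendsto (fun t : ℝ => ⟪flow w (-t) g, flow v t g⟫_ℂ) (𝓝[≠] 0) (𝓝 ((‖g‖ : ℂ) ^ 2)) := by
    have hc : Continuous fun t : ℝ => ⟪flow w (-t) g, flow v t g⟫_ℂ :=
      ((continuous_flow w g).comp continuous_neg).inner (continuous_flow v g)
    refine (hc.tendsto' 0 _ ?_).mono_left nhdsWithin_le_nhds
    rw [neg_zero, flow_zero, flow_zero, inner_self_eq_norm_sq_to_K]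
    rfl
  have hr := hchi.mul hin
  have heq := tendsto_nhds_unique (hl.congr fun t => ?_) hr
  · rw [inner_smul_left, inner_smul_right, inner_smul_left, inner_smul_right, conj_two_pi_I] at heq
    refine mul_left_cancel₀ Complex.two_pi_I_ne_zero ?_
    linear_combination heq
  · rw [inner_smul_left, inner_smul_right, inner_smul_left, inner_smul_right, mul_assoc, ← hweyl,
      Complex.conj_ofReal]
    push_cast
    ring

/-! ### Sums over separated sets -/

/-- Distinct points of `P` have distance at least `δ`. -/
def Sep {E : Type*} [PseudoMetricSpace E] (δ : ℝ) (P : Set E) : Prop :=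
  P.Pairwise fun p q => δ ≤ dist p q

theorem integrable_exp_neg_norm {E : Type*} [NormedAddCommGroup E] [NormedSpace ℝ E]
    [FiniteDimensional ℝ E] [MeasurableSpace E] [BorelSpace E] (μ : Measure E)
    [μ.IsAddHaarMeasure] {c : ℝ} (hc : 0 < c) :
    Integrable (fun z : E => Real.exp (-(c * ‖z‖))) μ := by
  set N := Module.finrank ℝ E + 1
  have h := (integrable_one_add_norm (E := E) (μ := μ) (r := (N : ℝ))
    (by simp [N])).const_mul (Real.exp c * (N.factorial / c ^ N))
  refine h.mono' (Continuous.aestronglyMeasurable (by fun_prop)) (.of_forall fun z => ?_)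
  rw [Real.norm_of_nonneg (Real.exp_pos _).le, Real.rpow_neg (by positivity), Real.rpow_natCast]
  have h1 := Real.pow_div_factorial_le_exp (x := c * (1 + ‖z‖)) (by positivity) N
  rw [mul_pow] at h1
  have h2 : Real.exp (-(c * ‖z‖)) = Real.exp c / Real.exp (c * (1 + ‖z‖)) := by
    rw [← Real.exp_sub]
    ring_nf
  rw [h2, div_le_iff₀ (Real.exp_pos _), mul_assoc, mul_assoc]
  refine le_mul_of_one_le_right (Real.exp_pos _).le ?_
  calc (1 : ℝ) = (N.factorial / c ^ N) * (((1 + ‖z‖) ^ N)⁻¹ *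
        (c ^ N * (1 + ‖z‖) ^ N / N.factorial)) := by
        have : (N.factorial : ℝ) ≠ 0 := by positivity
        have : (1 + ‖z‖) ^ N ≠ 0 := by positivity
        field_simp
    _ ≤ _ := by gcongr

/-- The balls of radius `δ / 2` around the points of a `δ`-separated set are disjoint, so that sums
over the set are controlled by integrals. -/
theorem exists_sum_exp_neg_le {E : Type*} [NormedAddCommGroup E] [NormedSpace ℝ E]
    [FiniteDimensional ℝ E] {c δ : ℝ} (hc : 0 < c) (hδ : 0 < δ) :
    ∃ M : ℝ, 0 ≤ M ∧ ∀ (P : Finset E), Sep δ (P : Set E) → ∀ z : E,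
      ∑ p ∈ P, Real.exp (-(c * ‖p - z‖)) ≤ M := by
  borelize E
  let μ : Measure E := Measure.addHaar
  have hint := integrable_exp_neg_norm (E := E) μ hc
  set V := μ.real (Metric.ball (0 : E) (δ / 2))
  have hV : 0 < V := by
    refine ENNReal.toReal_pos (Metric.measure_ball_pos μ _ (by positivity)).ne' ?_
    exact measure_ball_lt_top.ne
  refine ⟨Real.exp (c * (δ / 2)) * (∫ x : E, Real.exp (-(c * ‖x‖)) ∂μ) / V, by positivity,
    fun P hP z => ?_⟩
  have hint' : Integrable (fun x : E => Real.exp (c * (δ / 2)) * Real.exp (-(c * ‖x - z‖))) μ :=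
    (hint.comp_sub_right z).const_mul _
  rw [le_div_iff₀ hV, Finset.sum_mul]
  calc ∑ p ∈ P, Real.exp (-(c * ‖p - z‖)) * V
      ≤ ∑ p ∈ P, ∫ x in Metric.ball p (δ / 2),
          Real.exp (c * (δ / 2)) * Real.exp (-(c * ‖x - z‖)) ∂μ := by
        refine Finset.sum_le_sum fun p _ => ?_
        have hVp : V = μ.real (Metric.ball p (δ / 2)) := by
          simp only [V, Measure.real, Measure.addHaar_ball_center μ p]
        rw [hVp, mul_comm, ← smul_eq_mul, ← setIntegral_const]
        refine setIntegral_mono_on (integrableOn_const measure_ball_lt_top.ne)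
          hint'.integrableOn measurableSet_ball fun x hx => ?_
        rw [← Real.exp_add, Real.exp_le_exp]
        rw [Metric.mem_ball, dist_eq_norm] at hx
        have : ‖x - z‖ ≤ ‖x - p‖ + ‖p - z‖ := norm_sub_le_norm_sub_add_norm_sub _ _ _
        nlinarith
    _ = ∫ x in ⋃ p ∈ P, Metric.ball p (δ / 2),
          Real.exp (c * (δ / 2)) * Real.exp (-(c * ‖x - z‖)) ∂μ := by
        refine (integral_biUnion_finset P (fun _ _ => measurableSet_ball) (fun p hp q hq hpq => ?_)
          fun _ _ => hint'.integrableOn).symm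
        exact Metric.ball_disjoint_ball (by linarith [hP hp hq hpq])
    _ ≤ ∫ x, Real.exp (c * (δ / 2)) * Real.exp (-(c * ‖x - z‖)) ∂μ :=
        setIntegral_le_integral hint' (.of_forall fun x => by positivity)
    _ = Real.exp (c * (δ / 2)) * ∫ x : E, Real.exp (-(c * ‖x‖)) ∂μ := by
        rw [integral_const_mul, integral_sub_right_eq_self (fun x => Real.exp (-(c * ‖x‖))) z]

/-! ### The Gaussian -/

theorem memLp_gaussian :
    MemLp (fun x : Space d => Complex.exp (-Real.pi * ‖x‖ ^ 2)) 2 (volume : Measure (Space d)) := by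
  have hc : Continuous fun x : Space d => Complex.exp (-Real.pi * ‖x‖ ^ 2) := by fun_prop
  rw [memLp_two_iff_integrable_sq_norm hc.aestronglyMeasurable]
  have h := (GaussianFourier.integrable_cexp_neg_mul_sq_norm_add (V := Space d)
    (b := (2 * Real.pi : ℝ)) (by rw [Complex.ofReal_re]; positivity) 0 0).norm
  refine h.congr (.of_forall fun x => ?_)
  simp only [Complex.norm_exp, ← Real.exp_nat_mul]
  congr 1
  norm_cast
  simp
  ring

/-- The Gaussian `e^{-π|x|²}` as an element of `L²(ℝ^d)`. -/
def gauss : L2 d := memLp_gaussian.toLp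

theorem gauss_ae : (gauss : L2 d) =ᵐ[volume] fun x => Complex.exp (-Real.pi * ‖x‖ ^ 2) :=
  memLp_gaussian.coeFn_toLp

/-- The ambiguity function of the Gaussian is, up to unimodular factors, again a Gaussian. -/
theorem inner_gauss_tf_gauss (p : Phase d) :
    ⟪gauss, tf p gauss⟫_ℂ = chi (-(⟪p.2, p.1⟫_ℝ / 2)) * Complex.exp (-(Real.pi / 2) * ‖p.1‖ ^ 2) *
      ((Real.pi / (2 * Real.pi)) ^ (Module.finrank ℝ (Space d) / 2 : ℂ) *
        Complex.exp (-(Real.pi / 2) * ‖p.2‖ ^ 2)) := by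
  have h := GaussianFourier.integral_cexp_neg_mul_sq_norm_add (V := Space d)
    (b := 2 * Real.pi) (by simpa using Real.pi_pos) (2 * Real.pi * Complex.I) p.2
  have hexp : (2 * Real.pi * Complex.I) ^ 2 * (‖p.2‖ : ℂ) ^ 2 / (4 * (2 * Real.pi))
      = -(Real.pi / 2) * ‖p.2‖ ^ 2 := by
    have : (Real.pi : ℂ) ≠ 0 := by simp [Real.pi_ne_zero]
    field_simp
    rw [Complex.I_sq]
    ring
  rw [hexp] at h
  rw [← h, inner_eq_integral, ← integral_const_mul,
    ← integral_add_right_eq_self (fun y : Space d => chi (-(⟪p.2, p.1⟫_ℝ / 2)) *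
      Complex.exp (-(Real.pi / 2) * ‖p.1‖ ^ 2) * Complex.exp (-(2 * Real.pi) * ‖y‖ ^ 2 +
        2 * Real.pi * Complex.I * ⟪p.2, y⟫_ℝ)) ((1 / 2 : ℝ) • p.1)]
  refine integral_congr_ae ?_
  filter_upwards [gauss_ae (d := d), tf_ae p gauss, ae_add_right (gauss_ae (d := d)) p.1]
    with x h1 h2 h3
  rw [h1, h2, h3, ← Complex.exp_conj, chi, chi, ← Complex.exp_add, ← Complex.exp_add,
    ← Complex.exp_add, ← Complex.exp_add]
  congr 1
  -- The parallelogram law centres the product of the two Gaussians.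
  have e1 : ‖x + (1 / 2 : ℝ) • p.1‖ ^ 2 = ‖x‖ ^ 2 + ⟪x, p.1⟫_ℝ + ‖p.1‖ ^ 2 / 4 := by
    rw [norm_add_sq_real, inner_smul_right, norm_smul, mul_pow]
    norm_num
    ring
  have e2 : ‖x + p.1‖ ^ 2 = ‖x‖ ^ 2 + 2 * ⟪x, p.1⟫_ℝ + ‖p.1‖ ^ 2 := norm_add_sq_real _ _
  have e3 : ⟪p.2, x + (1 / 2 : ℝ) • p.1⟫_ℝ = ⟪p.2, x⟫_ℝ + ⟪p.2, p.1⟫_ℝ / 2 := by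
    rw [inner_add_right, inner_smul_right]
    ring
  rw [e3]
  simp only [← Complex.ofReal_pow, e1, e2, map_mul, map_neg, Complex.conj_ofReal]
  push_cast
  ring

/-- The ambiguity function of the Gaussian decays exponentially. -/
theorem exists_norm_inner_tf_gauss_le :
    ∃ C : ℝ, 0 ≤ C ∧ ∀ p : Phase d, ‖⟪tf p gauss, gauss⟫_ℂ‖ ≤ C * Real.exp (-‖p‖) := by
  refine ⟨‖((Real.pi / (2 * Real.pi)) ^ (Module.finrank ℝ (Space d) / 2 : ℂ) : ℂ)‖ * Real.exp 1,
    by positivity, fun p => ?_⟩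
  have e : ∀ t : ℝ, ‖Complex.exp (-(Real.pi / 2) * (t : ℂ) ^ 2)‖
      = Real.exp (-(Real.pi / 2) * t ^ 2) := by
    intro t
    rw [← Complex.norm_of_nonneg (Real.exp_pos (-(Real.pi / 2) * t ^ 2)).le]
    push_cast
    rfl
  rw [norm_inner_symm, inner_gauss_tf_gauss, norm_mul, norm_mul, norm_mul, norm_chi, one_mul, e, e,
    mul_left_comm, mul_assoc]
  refine mul_le_mul_of_nonneg_left ?_ (norm_nonneg _)
  rw [← Real.exp_add, ← Real.exp_add, Real.exp_le_exp]
  have hq : ∀ t : ℝ, t ≤ 1 + Real.pi / 2 * t ^ 2 := fun t => by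
    nlinarith [Real.pi_gt_three, sq_nonneg (t - 1)]
  have h1 : 0 ≤ Real.pi / 2 * ‖p.1‖ ^ 2 := by positivity
  have h2 : 0 ≤ Real.pi / 2 * ‖p.2‖ ^ 2 := by positivity
  have h3 : ‖p‖ ≤ 1 + Real.pi / 2 * ‖p.1‖ ^ 2 + Real.pi / 2 * ‖p.2‖ ^ 2 := by
    rw [Prod.norm_def]
    exact max_le (by linarith [hq ‖p.1‖]) (by linarith [hq ‖p.2‖])
  linarith

/-- The modulations of the Gaussian span a dense subspace: a function orthogonal to all of them
has a product with the Gaussian whose Fourier transform vanishes. -/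
theorem span_tf_gauss_dense :
    (Submodule.span ℂ (Set.range fun n : Space d => tf (0, n) gauss)).topologicalClosure = ⊤ := by
  rw [Submodule.topologicalClosure_eq_top_iff, Submodule.eq_bot_iff]
  intro f hf
  have hf0 : ∀ n : Space d, ⟪tf (0, n) gauss, f⟫_ℂ = 0 := fun n =>
    (Submodule.mem_orthogonal _ f).mp hf _ (Submodule.subset_span ⟨n, rfl⟩)
  let u : Space d → ℂ := fun x => conj ((gauss : L2 d) x) * f x
  have hu : Integrable u := integrable_conj_mul _ _
  have hF : ∀ n, FourierTransform.fourier u n = 0 := by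
    intro n
    rw [← hf0 n, inner_eq_integral, Real.fourier_eq']
    refine integral_congr_ae ?_
    filter_upwards [tf_ae (0, n) gauss] with x hx
    rw [hx, map_mul, conj_chi, add_zero, mul_assoc, smul_eq_mul, chi, real_inner_comm]
    push_cast
    simp only [u]
    ring_nf
  have hu0 : ∀ᵐ x, u x = 0 := by
    refine ae_eq_zero_of_integral_contDiff_smul_eq_zero hu.locallyIntegrable fun φ hφ hc => ?_
    have hc' : HasCompactSupport (fun x => (φ x : ℂ)) :=
      hc.comp_left (g := Complex.ofReal) Complex.ofReal_zero
    let ψ : 𝓢(Space d, ℂ) := hc'.toSchwartzMap (Complex.ofRealCLM.contDiff.comp hφ)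
    have h1 := VectorFourier.integral_fourierIntegral_smul_eq_flip (L := innerₗ (Space d))
      (μ := volume) (ν := volume) Real.continuous_fourierChar continuous_inner hu
      (FourierTransformInv.fourierInv ψ).integrable
    have h2 : ∀ x, FourierTransform.fourier
        ((FourierTransformInv.fourierInv ψ : 𝓢(Space d, ℂ)) : Space d → ℂ) x = ψ x := by
      intro x
      rw [← SchwartzMap.fourier_coe, FourierTransform.fourier_fourierInv_eq]
    have h3 : ∫ x, u x • ψ x = 0 := by
      rw [flip_innerₗ] at h1
      calc ∫ x, u x • ψ x = ∫ x, u x • FourierTransform.fourier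
            ((FourierTransformInv.fourierInv ψ : 𝓢(Space d, ℂ)) : Space d → ℂ) x := by simp_rw [h2]
        _ = ∫ n, FourierTransform.fourier u n •
            (FourierTransformInv.fourierInv ψ : 𝓢(Space d, ℂ)) n := h1.symm
        _ = 0 := by simp [hF]
    rw [← h3]
    refine integral_congr_ae (.of_forall fun x => ?_)
    change (φ x : ℂ) * u x = u x * (φ x : ℂ)
    exact mul_comm _ _
  rw [Lp.eq_zero_iff_ae_eq_zero]
  filter_upwards [hu0, gauss_ae (d := d)] with x h1 h2
  have h3 : conj ((gauss : L2 d) x) ≠ 0 := by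
    rw [h2, ← Complex.exp_conj]
    exact Complex.exp_ne_zero _
  exact (mul_eq_zero.mp h1).resolve_left h3

/-! ### Uniformly small tails -/

/-- The Schur test for a finite family of vectors: absolute row sums of the Gram matrix bound the
Bessel constant. -/
theorem sum_sq_norm_inner_le {ι H : Type*} [NormedAddCommGroup H] [InnerProductSpace ℂ H]
    (P : Finset ι) (u : ι → H) {M : ℝ} (hM0 : 0 ≤ M)
    (hM : ∀ i ∈ P, ∑ j ∈ P, ‖⟪u i, u j⟫_ℂ‖ ≤ M) (a : H) :
    ∑ i ∈ P, ‖⟪u i, a⟫_ℂ‖ ^ 2 ≤ M * ‖a‖ ^ 2 := by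
  set S := ∑ i ∈ P, ‖⟪u i, a⟫_ℂ‖ ^ 2 with hS
  have hS0 : 0 ≤ S := Finset.sum_nonneg fun _ _ => by positivity
  set w := ∑ i ∈ P, ⟪u i, a⟫_ℂ • u i with hw
  have h1 : ⟪w, a⟫_ℂ = (S : ℂ) := by
    rw [hw, sum_inner, hS]
    push_cast
    refine Finset.sum_congr rfl fun i _ => ?_
    rw [inner_smul_left, Complex.conj_mul']
  have h2 : ‖w‖ ^ 2 ≤ M * S := by
    calc ‖w‖ ^ 2 = ‖⟪w, w⟫_ℂ‖ := by rw [inner_self_eq_norm_sq_to_K]; simp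
      _ = ‖∑ i ∈ P, ∑ j ∈ P, conj ⟪u i, a⟫_ℂ * (⟪u j, a⟫_ℂ * ⟪u i, u j⟫_ℂ)‖ := by
          rw [hw, sum_inner]
          simp only [inner_sum, inner_smul_left, inner_smul_right, mul_left_comm]
      _ ≤ ∑ i ∈ P, ∑ j ∈ P, ‖⟪u i, a⟫_ℂ‖ * (‖⟪u j, a⟫_ℂ‖ * ‖⟪u i, u j⟫_ℂ‖) := by
          refine (norm_sum_le _ _).trans (Finset.sum_le_sum fun i _ =>
            (norm_sum_le _ _).trans (Finset.sum_le_sum fun j _ => ?_))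
          rw [norm_mul, norm_mul, RCLike.norm_conj]
      _ ≤ ∑ i ∈ P, ∑ j ∈ P, (‖⟪u i, a⟫_ℂ‖ ^ 2 * ‖⟪u i, u j⟫_ℂ‖
            + ‖⟪u j, a⟫_ℂ‖ ^ 2 * ‖⟪u i, u j⟫_ℂ‖) / 2 := by
          refine Finset.sum_le_sum fun i _ => Finset.sum_le_sum fun j _ => ?_
          nlinarith [mul_nonneg (sq_nonneg (‖⟪u i, a⟫_ℂ‖ - ‖⟪u j, a⟫_ℂ‖))
            (norm_nonneg ⟪u i, u j⟫_ℂ)]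
      _ = ∑ i ∈ P, ∑ j ∈ P, ‖⟪u i, a⟫_ℂ‖ ^ 2 * ‖⟪u i, u j⟫_ℂ‖ := by
          have hsymm : ∑ i ∈ P, ∑ j ∈ P, ‖⟪u j, a⟫_ℂ‖ ^ 2 * ‖⟪u i, u j⟫_ℂ‖
              = ∑ i ∈ P, ∑ j ∈ P, ‖⟪u i, a⟫_ℂ‖ ^ 2 * ‖⟪u i, u j⟫_ℂ‖ := by
            rw [Finset.sum_comm]
            refine Finset.sum_congr rfl fun i _ => Finset.sum_congr rfl fun j _ => ?_
            rw [norm_inner_symm (u j) (u i)]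
          simp_rw [← Finset.sum_div, Finset.sum_add_distrib]
          rw [hsymm]
          ring
      _ ≤ ∑ i ∈ P, ‖⟪u i, a⟫_ℂ‖ ^ 2 * M := by
          refine Finset.sum_le_sum fun i hi => ?_
          rw [← Finset.mul_sum]
          exact mul_le_mul_of_nonneg_left (hM i hi) (by positivity)
      _ = M * S := by rw [← Finset.sum_mul, mul_comm]
  have h3 : S ≤ ‖w‖ * ‖a‖ := by
    have := norm_inner_le_norm (𝕜 := ℂ) w a
    rwa [h1, Complex.norm_real, Real.norm_of_nonneg hS0] at this
  rcases hS0.eq_or_lt with h0 | h0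
  · rw [← h0]
    positivity
  · have h4 : S * S ≤ S * (M * ‖a‖ ^ 2) := by
      calc S * S ≤ (‖w‖ * ‖a‖) * (‖w‖ * ‖a‖) := by gcongr
        _ = ‖w‖ ^ 2 * ‖a‖ ^ 2 := by ring
        _ ≤ (M * S) * ‖a‖ ^ 2 := by gcongr
        _ = S * (M * ‖a‖ ^ 2) := by ring
    exact le_of_mul_le_mul_left h4 h0

/-- A family of quadratic quantities `q i`, uniformly bounded by a multiple of the squared norm,
that tends to zero at each vector of a set with dense span, tends to zero at every vector. The
predicate `R r` singles out the indices regarded as being beyond `r`. -/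
theorem tail_of_dense {I H : Type*} [NormedAddCommGroup H] [InnerProductSpace ℂ H]
    (R : ℝ → I → Prop) (hR : ∀ r r' i, r ≤ r' → R r' i → R r i) (q : I → H → ℝ) {C : ℝ}
    (hC : 0 ≤ C) (hadd : ∀ i f f', q i (f + f') ≤ 2 * q i f + 2 * q i f')
    (hsmul : ∀ i (c : ℂ) f, q i (c • f) = ‖c‖ ^ 2 * q i f) (hb : ∀ i f, q i f ≤ C * ‖f‖ ^ 2)
    {D : Set H} (hD : (Submodule.span ℂ D).topologicalClosure = ⊤)
    (h : ∀ f ∈ D, ∀ ε > 0, ∃ r, ∀ i, R r i → q i f ≤ ε) (f : H) :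
    ∀ ε > 0, ∃ r, ∀ i, R r i → q i f ≤ ε := by
  have hspan : ∀ f ∈ Submodule.span ℂ D, ∀ ε > 0, ∃ r, ∀ i, R r i → q i f ≤ ε := by
    intro f hf
    induction hf using Submodule.span_induction with
    | mem f hf => exact h f hf
    | zero =>
      intro ε hε
      exact ⟨0, fun i _ => (hb i 0).trans (by simpa using hε.le)⟩
    | add f f' _ _ h1 h2 =>
      intro ε hε
      obtain ⟨r, hr⟩ := h1 (ε / 4) (by positivity)
      obtain ⟨r', hr'⟩ := h2 (ε / 4) (by positivity)
      refine ⟨max r r', fun i hi => ?_⟩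
      linarith [hadd i f f', hr i (hR _ _ i (le_max_left _ _) hi),
        hr' i (hR _ _ i (le_max_right _ _) hi)]
    | smul c f _ h1 =>
      intro ε hε
      obtain ⟨r, hr⟩ := h1 (ε / (‖c‖ ^ 2 + 1)) (by positivity)
      refine ⟨r, fun i hi => ?_⟩
      rw [hsmul]
      calc ‖c‖ ^ 2 * q i f ≤ ‖c‖ ^ 2 * (ε / (‖c‖ ^ 2 + 1)) := by gcongr; exact hr i hi
        _ ≤ (‖c‖ ^ 2 + 1) * (ε / (‖c‖ ^ 2 + 1)) := by gcongr; linarith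
        _ = ε := by field_simp
  intro ε hε
  have hf : f ∈ (Submodule.span ℂ D).topologicalClosure := hD ▸ Submodule.mem_top
  rw [← SetLike.mem_coe, Submodule.topologicalClosure_coe, Metric.mem_closure_iff] at hf
  obtain ⟨f', hf', hdist⟩ := hf (Real.sqrt (ε / (4 * (C + 1)))) (by positivity)
  obtain ⟨r, hr⟩ := hspan f' hf' (ε / 4) (by positivity)
  refine ⟨r, fun i hi => ?_⟩
  have h1 : ‖f - f'‖ ^ 2 ≤ ε / (4 * (C + 1)) := by
    rw [← dist_eq_norm, ← Real.sq_sqrt (show 0 ≤ ε / (4 * (C + 1)) by positivity)]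
    gcongr
  have h2 : C * ‖f - f'‖ ^ 2 ≤ ε / 4 := by
    calc C * ‖f - f'‖ ^ 2 ≤ (C + 1) * (ε / (4 * (C + 1))) := by gcongr; linarith
      _ = ε / 4 := by field_simp
  have h3 := hadd i (f - f') f'
  rw [sub_add_cancel] at h3
  linarith [hb i (f - f'), hr i hi]

theorem sq_norm_add_le (x y : ℂ) : ‖x + y‖ ^ 2 ≤ 2 * ‖x‖ ^ 2 + 2 * ‖y‖ ^ 2 := by
  have h := norm_add_le x y
  nlinarith [norm_nonneg (x + y), sq_nonneg (‖x‖ - ‖y‖)]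

theorem Sep.image_sub {δ : ℝ} {P : Finset (Phase d)} (hP : Sep δ (P : Set (Phase d)))
    (z : Phase d) : Sep δ ((P.map (Equiv.subRight z).toEmbedding : Finset (Phase d)) :
      Set (Phase d)) := by
  intro p hp q hq hpq
  simp only [Finset.coe_map, Set.mem_image] at hp hq
  obtain ⟨p, hp, rfl⟩ := hp
  obtain ⟨q, hq, rfl⟩ := hq
  simpa using hP hp hq (fun h => hpq (by rw [h]))

theorem norm_inner_tf_tf (p q : Phase d) (f g : L2 d) :
    ‖⟪tf p f, tf q g⟫_ℂ‖ = ‖⟪tf (p - q) f, g⟫_ℂ‖ := by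
  rw [← norm_inner_tf_add_tf (p - q) q, sub_add_cancel]

/-- Time-frequency shifts of the Gaussian along separated sets are Bessel sequences. -/
theorem exists_bessel_gauss {δ : ℝ} (hδ : 0 < δ) :
    ∃ C : ℝ, 0 ≤ C ∧ ∀ P : Finset (Phase d), Sep δ (P : Set (Phase d)) → ∀ a : L2 d,
      ∑ p ∈ P, ‖⟪tf p a, gauss⟫_ℂ‖ ^ 2 ≤ C * ‖a‖ ^ 2 := by
  obtain ⟨C, hC, hdecay⟩ := exists_norm_inner_tf_gauss_le (d := d)
  obtain ⟨M, hM, hsum⟩ := exists_sum_exp_neg_le (E := Phase d) one_pos hδ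
  refine ⟨C * M, by positivity, fun P hP a => ?_⟩
  have h := sum_sq_norm_inner_le P (fun p => tf (-p) gauss) (mul_nonneg hC hM) (fun p _ => ?_) a
  · refine le_trans (le_of_eq (Finset.sum_congr rfl fun p _ => ?_)) h
    have h1 := norm_inner_tf_tf 0 (-p) a gauss
    rw [zero_sub, neg_neg, tf_zero] at h1
    rw [← h1, norm_inner_symm]
  · calc ∑ q ∈ P, ‖⟪tf (-p) gauss, tf (-q) gauss⟫_ℂ‖
        ≤ ∑ q ∈ P, C * Real.exp (-(1 * ‖q - p‖)) := by
          refine Finset.sum_le_sum fun q _ => ?_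
          rw [norm_inner_tf_tf, one_mul, neg_sub_neg]
          exact hdecay _
      _ ≤ C * M := by
          rw [← Finset.mul_sum]
          exact mul_le_mul_of_nonneg_left (hsum P hP p) hC

/-- Matrix coefficients against the Gaussian have small sums of squares over separated sets far
from the origin. -/
theorem tail_gauss {δ : ℝ} (hδ : 0 < δ) (a : L2 d) : ∀ ε > 0, ∃ r : ℝ,
    ∀ P : Finset (Phase d), Sep δ (P : Set (Phase d)) → (∀ p ∈ P, r ≤ ‖p‖) →
      ∑ p ∈ P, ‖⟪tf p a, gauss⟫_ℂ‖ ^ 2 ≤ ε := by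
  obtain ⟨B, hB, hbessel⟩ := exists_bessel_gauss (d := d) hδ
  obtain ⟨C, hC, hdecay⟩ := exists_norm_inner_tf_gauss_le (d := d)
  obtain ⟨M, hM, hsum⟩ := exists_sum_exp_neg_le (E := Phase d) one_pos hδ
  have key := tail_of_dense (I := {P : Finset (Phase d) // Sep δ (P : Set (Phase d))}) (H := L2 d)
    (fun r P => ∀ p ∈ P.1, r ≤ ‖p‖) (fun r r' P hr h p hp => hr.trans (h p hp))
    (fun P a => ∑ p ∈ P.1, ‖⟪tf p a, gauss⟫_ℂ‖ ^ 2) hB (fun P f f' => ?_) (fun P c f => ?_)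
    (fun P f => hbessel P.1 P.2 f) span_tf_gauss_dense ?_ a
  · intro ε hε
    obtain ⟨r, hr⟩ := key ε hε
    exact ⟨r, fun P hP h => hr ⟨P, hP⟩ h⟩
  · rw [Finset.mul_sum, Finset.mul_sum, ← Finset.sum_add_distrib]
    refine Finset.sum_le_sum fun p _ => ?_
    rw [map_add, inner_add_left]
    exact sq_norm_add_le _ _
  · rw [Finset.mul_sum]
    refine Finset.sum_congr rfl fun p _ => ?_
    rw [map_smul, inner_smul_left, norm_mul, RCLike.norm_conj, mul_pow]
  · rintro _ ⟨n, rfl⟩ ε hε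
    set q : Phase d := (0, n)
    have hlim : Tendsto (fun r : ℝ => C ^ 2 * Real.exp (‖q‖ - r) * M) atTop (𝓝 0) := by
      have : Tendsto (fun r : ℝ => ‖q‖ - r) atTop atBot :=
        tendsto_atBot_add_const_left _ _ tendsto_neg_atTop_atBot
      simpa using ((Real.tendsto_exp_atBot.comp this).const_mul (C ^ 2)).mul_const M
    obtain ⟨r, hr⟩ := (hlim.eventually (ge_mem_nhds hε)).exists
    refine ⟨r, fun P hP => le_trans ?_ hr⟩
    calc ∑ p ∈ P.1, ‖⟪tf p (tf q gauss), gauss⟫_ℂ‖ ^ 2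
        ≤ ∑ p ∈ P.1, C ^ 2 * Real.exp (‖q‖ - r) * Real.exp (-(1 * ‖p - -q‖)) := by
          refine Finset.sum_le_sum fun p hp => ?_
          have h1 : ‖⟪tf p (tf q gauss), gauss⟫_ℂ‖ ≤ C * Real.exp (-‖p - -q‖) := by
            rw [tf_tf, inner_smul_left, norm_mul, RCLike.norm_conj, norm_chi, one_mul,
              sub_neg_eq_add]
            exact hdecay _
          calc _ ≤ (C * Real.exp (-‖p - -q‖)) ^ 2 := by gcongr
            _ = C ^ 2 * Real.exp (-‖p - -q‖) * Real.exp (-(1 * ‖p - -q‖)) := by rw [one_mul]; ring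
            _ ≤ _ := by
              gcongr
              have h2 : ‖p‖ ≤ ‖p - -q‖ + ‖q‖ := by
                simpa using norm_sub_le (p - -q) q
              linarith [hP p hp]
      _ ≤ _ := by
          rw [← Finset.mul_sum]
          exact mul_le_mul_of_nonneg_left (hsum P.1 P.2 _) (by positivity)

/-- Matrix coefficients against modulated Gaussians vanish at infinity, so a nonzero vector cannot
have matrix coefficients of constant modulus along a line. -/
theorem eq_zero_of_norm_inner_tf_eq {z : Phase d} (hz : z ≠ 0) (g : L2 d)
    (h : ∀ (t : ℝ) (f : L2 d), ‖⟪tf (t • z) g, f⟫_ℂ‖ = ‖⟪g, f⟫_ℂ‖) : g = 0 := by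
  have h0 : ∀ n : Space d, ⟪tf (0, n) gauss, g⟫_ℂ = 0 := by
    intro n
    rw [← norm_eq_zero, norm_inner_symm]
    by_contra hne
    have hpos : 0 < ‖⟪g, tf (0, n) gauss⟫_ℂ‖ := (norm_nonneg _).lt_of_ne' hne
    obtain ⟨r, hr⟩ := tail_gauss one_pos g (‖⟪g, tf (0, n) gauss⟫_ℂ‖ ^ 2 / 2) (by positivity)
    have hzn : 0 < ‖z‖ := norm_pos_iff.mpr hz
    set t : ℝ := (|r| + ‖((0, n) : Phase d)‖) / ‖z‖
    have h1 := hr {t • z - (0, n)} (by simp [Sep]) (by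
      intro p hp
      rw [Finset.mem_singleton.mp hp]
      have h2 : ‖t • z‖ = |r| + ‖((0, n) : Phase d)‖ := by
        rw [norm_smul, Real.norm_of_nonneg (by positivity)]
        simp only [t]
        field_simp
      linarith [norm_sub_norm_le (t • z) ((0, n) : Phase d), le_abs_self r])
    rw [Finset.sum_singleton, ← norm_inner_tf_tf, h] at h1
    nlinarith
  have hg : g ∈ (Submodule.span ℂ (Set.range fun n : Space d => tf (0, n) gauss))ᗮ := by
    rw [Submodule.mem_orthogonal]
    intro u hu
    induction hu using Submodule.span_induction with
    | mem u hu => obtain ⟨n, rfl⟩ := hu; exact h0 n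
    | zero => exact inner_zero_left _
    | add x y _ _ hx hy => rw [inner_add_left, hx, hy, add_zero]
    | smul c x _ hx => rw [inner_smul_left, hx, mul_zero]
  rw [Submodule.topologicalClosure_eq_top_iff.mp span_tf_gauss_dense] at hg
  exact (Submodule.mem_bot ℂ).mp hg

/-- For an orthonormal system of time-frequency shifts of `g` along a separated set `Λ`, the
coefficients of the shifts of `f` are concentrated near the diagonal, uniformly. -/
theorem tail_orthonormal {δ : ℝ} (hδ : 0 < δ) {Λ : Set (Phase d)} (hΛ : Sep δ Λ) {g : L2 d}
    (hg : Orthonormal ℂ fun p : Λ => tf (p : Phase d) g) (f : L2 d) : ∀ ε > 0, ∃ r : ℝ,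
    ∀ (l : Phase d) (P : Finset Λ), (∀ p ∈ P, r ≤ ‖(p : Phase d) - l‖) →
      ∑ p ∈ P, ‖⟪tf (p : Phase d) g, tf l f⟫_ℂ‖ ^ 2 ≤ ε := by
  have key := tail_of_dense (I := Phase d × Finset Λ) (H := L2 d)
    (fun r i => ∀ p ∈ i.2, r ≤ ‖(p : Phase d) - i.1‖) (fun r r' i hr h p hp => hr.trans (h p hp))
    (fun i f => ∑ p ∈ i.2, ‖⟪tf (p : Phase d) g, tf i.1 f⟫_ℂ‖ ^ 2) zero_le_one (fun i f f' => ?_)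
    (fun i c f => ?_) (fun i f => ?_) span_tf_gauss_dense ?_ f
  · intro ε hε
    obtain ⟨r, hr⟩ := key ε hε
    exact ⟨r, fun l P h => hr (l, P) h⟩
  · rw [Finset.mul_sum, Finset.mul_sum, ← Finset.sum_add_distrib]
    refine Finset.sum_le_sum fun p _ => ?_
    rw [map_add, inner_add_right]
    exact sq_norm_add_le _ _
  · rw [Finset.mul_sum]
    refine Finset.sum_congr rfl fun p _ => ?_
    rw [map_smul, inner_smul_right, norm_mul, mul_pow]
  · rw [one_mul, ← (tf i.1).norm_map f]
    exact hg.sum_inner_products_le _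
  · rintro _ ⟨n, rfl⟩ ε hε
    set q : Phase d := (0, n)
    obtain ⟨r, hr⟩ := tail_gauss hδ g ε hε
    refine ⟨r + ‖q‖, fun i hi => ?_⟩
    have hsep : Sep δ ((i.2.map (Function.Embedding.subtype (· ∈ Λ)) : Finset (Phase d)) :
        Set (Phase d)) := by
      refine hΛ.mono fun p hp => ?_
      simp only [Finset.coe_map, Set.mem_image] at hp
      obtain ⟨p, -, rfl⟩ := hp
      exact p.2
    have h := hr _ (hsep.image_sub (i.1 + q)) ?_
    · rw [Finset.sum_map, Finset.sum_map] at h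
      refine le_trans (le_of_eq (Finset.sum_congr rfl fun p _ => ?_)) h
      rw [tf_tf, inner_smul_right, norm_mul, norm_chi, one_mul, norm_inner_tf_tf]
      rfl
    · intro p hp
      simp only [Finset.mem_map] at hp
      obtain ⟨_, ⟨p, hp, rfl⟩, rfl⟩ := hp
      have h1 := hi p hp
      have h2 := norm_sub_norm_le ((p : Phase d) - i.1) q
      change r ≤ ‖(p : Phase d) - (i.1 + q)‖
      rw [← sub_sub]
      linarith

/-- An orthonormal system of time-frequency shifts is indexed by a separated set. -/
theorem exists_sep_of_orthonormal {Λ : Set (Phase d)} {g : L2 d} (hg0 : g ≠ 0)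
    (hg : Orthonormal ℂ fun p : Λ => tf (p : Phase d) g) : ∃ δ > 0, Sep δ Λ := by
  have hc : Continuous fun p : Phase d => ⟪tf p g, g⟫_ℂ := (continuous_tf g).inner continuous_const
  have h0 : ⟪tf (0 : Phase d) g, g⟫_ℂ ≠ 0 := by
    rw [tf_zero]
    exact inner_self_ne_zero.mpr hg0
  obtain ⟨δ, hδ, h⟩ := Metric.eventually_nhds_iff.mp (hc.continuousAt.eventually_ne h0)
  refine ⟨δ, hδ, fun p hp q hq hpq => ?_⟩
  by_contra hlt
  refine h (y := p - q) (by rwa [dist_zero_right, ← dist_eq_norm, ← not_le]) ?_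
  rw [← norm_eq_zero, ← norm_inner_tf_tf, norm_eq_zero]
  exact hg.2 (i := ⟨p, hp⟩) (j := ⟨q, hq⟩) (fun h => hpq (congrArg Subtype.val h))

/-! ### Averaging an antisymmetric kernel -/

/-- A kernel with row sums at most `B`, its rows weighted by a summable family `wt`, is summable
over pairs, with sum at most `B` times the total weight. -/
theorem summable_and_tsum_weighted_le {ι : Type*} {wt : ι → ℝ} (hwt : Summable wt)
    (hwt0 : ∀ i, 0 ≤ wt i) {c : ι → ι → ℝ} (hc : ∀ i j, 0 ≤ c i j) {B : ℝ}
    (hB : ∀ i (P : Finset ι), ∑ j ∈ P, c i j ≤ B) :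
    Summable (fun x : ι × ι => wt x.1 * c x.1 x.2) ∧
      ∑' x : ι × ι, wt x.1 * c x.1 x.2 ≤ (∑' i, wt i) * B := by
  have hrow : ∀ i, Summable (c i) := fun i => summable_of_sum_le (hc i) (hB i)
  have hle : ∀ i, ∑' j, c i j ≤ B := fun i => (hrow i).tsum_le_of_sum_le (hB i)
  have hcol : Summable fun i => ∑' j, wt i * c i j := by
    refine Summable.of_nonneg_of_le (fun i => tsum_nonneg fun j => mul_nonneg (hwt0 i) (hc i j))
      (fun i => ?_) (hwt.mul_right B)
    rw [tsum_mul_left]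
    exact mul_le_mul_of_nonneg_left (hle i) (hwt0 i)
  have hs : Summable (fun x : ι × ι => wt x.1 * c x.1 x.2) :=
    (summable_prod_of_nonneg (f := fun x : ι × ι => wt x.1 * c x.1 x.2)
      fun x => mul_nonneg (hwt0 x.1) (hc x.1 x.2)).mpr ⟨fun i => (hrow i).mul_left (wt i), hcol⟩
  have hprod : ∑' x : ι × ι, wt x.1 * c x.1 x.2 = ∑' i, ∑' j, wt i * c i j := hs.tsum_prod
  refine ⟨hs, ?_⟩
  rw [hprod, ← tsum_mul_right]
  refine hcol.tsum_le_tsum (fun i => ?_) (hwt.mul_right B)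
  rw [tsum_mul_left]
  exact mul_le_mul_of_nonneg_left (hle i) (hwt0 i)

/-- An antisymmetric kernel, absolutely summable along the rows and uniformly concentrated near the
diagonal, cannot have all its row sums equal to a nonzero constant, provided that the index set
grows subexponentially: average the row sums against `e^{-c‖·‖}` and let `c → 0`. -/
theorem eq_zero_of_antisymm_kernel {ι E : Type*} [Nonempty ι] [NormedAddCommGroup E] (pos : ι → E)
    (hpos : ∀ c > 0, Summable fun i => Real.exp (-(c * ‖pos i‖))) (t : ι → ι → ℝ) {κ M : ℝ}
    (hanti : ∀ i j, t j i = -t i j) (hκ : ∀ i, HasSum (t i) κ)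
    (hM : ∀ i (P : Finset ι), ∑ j ∈ P, |t i j| ≤ M)
    (htail : ∀ ε > 0, ∃ r : ℝ, ∀ i (P : Finset ι), (∀ j ∈ P, r ≤ ‖pos j - pos i‖) →
      ∑ j ∈ P, |t i j| ≤ ε) : κ = 0 := by
  classical
  have key : ∀ ε > 0, ∃ r : ℝ, ∀ c > 0, |κ| ≤ (Real.exp (c * r) - 1) * M + ε := by
    intro ε hε
    obtain ⟨r₀, hr₀⟩ := htail ε hε
    refine ⟨max r₀ 0, fun c hc => ?_⟩
    set r := max r₀ 0
    have hexp : 0 ≤ Real.exp (c * r) - 1 := by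
      rw [sub_nonneg]
      exact Real.one_le_exp (mul_nonneg hc.le (le_max_right _ _))
    let wt : ι → ℝ := fun i => Real.exp (-(c * ‖pos i‖))
    have hwt : Summable wt := hpos c hc
    have hwt0 : ∀ i, 0 < wt i := fun i => Real.exp_pos _
    have hW : 0 < ∑' i, wt i := hwt.tsum_pos (fun i => (hwt0 i).le) (Classical.arbitrary ι) (hwt0 _)
    let far : ι → ι → ℝ := fun i j => if r ≤ ‖pos j - pos i‖ then 1 else 0
    have hfar : ∀ i j, 0 ≤ far i j := fun i j => by
      simp only [far]
      split_ifs <;> simp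
    let G : ι × ι → ℝ := fun x => wt x.1 * (|t x.1 x.2| * ((Real.exp (c * r) - 1) + far x.1 x.2))
    obtain ⟨hG, hGle⟩ := summable_and_tsum_weighted_le (c := fun i j =>
      |t i j| * ((Real.exp (c * r) - 1) + far i j)) (B := (Real.exp (c * r) - 1) * M + ε) hwt
      (fun i => (hwt0 i).le)
      (fun i j => mul_nonneg (abs_nonneg _) (add_nonneg hexp (hfar i j))) (fun i P => by
        have h1 : ∑ j ∈ P, |t i j| * far i j ≤ ε := by
          simp only [far, mul_ite, mul_one, mul_zero]
          rw [← Finset.sum_filter]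
          exact hr₀ i _ fun j hj => (le_max_left _ _).trans (Finset.mem_filter.mp hj).2
        have h2 : ∑ j ∈ P, |t i j| * (Real.exp (c * r) - 1) ≤ (Real.exp (c * r) - 1) * M := by
          rw [← Finset.sum_mul, mul_comm]
          exact mul_le_mul_of_nonneg_left (hM i P) hexp
        simp_rw [mul_add, Finset.sum_add_distrib]
        exact add_le_add h2 h1)
    have hA' := (summable_and_tsum_weighted_le (c := fun i j => |t i j|) hwt (fun i => (hwt0 i).le)
      (fun i j => abs_nonneg _) hM).1
    have hA : Summable fun x : ι × ι => wt x.1 * t x.1 x.2 :=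
      hA'.of_norm_bounded fun x => by
        rw [norm_mul, Real.norm_of_nonneg (hwt0 _).le, Real.norm_eq_abs]
    have hAsum : ∑' x : ι × ι, wt x.1 * t x.1 x.2 = (∑' i, wt i) * κ := by
      have hprod : ∑' x : ι × ι, wt x.1 * t x.1 x.2 = ∑' i, ∑' j, wt i * t i j := hA.tsum_prod
      rw [hprod, ← tsum_mul_right]
      refine tsum_congr fun i => ?_
      rw [tsum_mul_left, (hκ i).tsum_eq]
    -- Adding the sum with the indices exchanged, where antisymmetry applies.
    have hdiff : HasSum (fun x : ι × ι => (wt x.1 - wt x.2) * t x.1 x.2)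
        ((∑' i, wt i) * κ + (∑' i, wt i) * κ) := by
      have h1 := hA.hasSum
      rw [hAsum] at h1
      have h2 := (Equiv.prodComm ι ι).hasSum_iff.mpr h1
      convert h1.add h2 using 1
      funext x
      simp only [Function.comp, Equiv.prodComm_apply, Prod.fst_swap, Prod.snd_swap,
        hanti x.1 x.2]
      ring
    have hG2 : HasSum (fun x : ι × ι => G x + G x.swap) (∑' x, G x + ∑' x, G x) :=
      hG.hasSum.add ((Equiv.prodComm ι ι).hasSum_iff.mpr hG.hasSum)
    have hbound : ∀ x : ι × ι, ‖(wt x.1 - wt x.2) * t x.1 x.2‖ ≤ G x + G x.swap := by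
      rintro ⟨i, j⟩
      have hfs : far j i = far i j := by simp only [far, norm_sub_rev]
      have hts : |t j i| = |t i j| := by rw [hanti, abs_neg]
      have h1 : |wt i - wt j| ≤ (wt i + wt j) * ((Real.exp (c * r) - 1) + far i j) := by
        by_cases hf : r ≤ ‖pos j - pos i‖
        · have : far i j = 1 := if_pos hf
          rw [this, abs_le]
          constructor <;> nlinarith [hwt0 i, hwt0 j, mul_nonneg (hwt0 i).le hexp,
            mul_nonneg (hwt0 j).le hexp]
        · have h0 : far i j = 0 := if_neg hf
          -- Nearby points have almost equal weights.
          have hnear : ∀ a b : ι, ‖pos b - pos a‖ ≤ r → wt a ≤ Real.exp (c * r) * wt b := by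
            intro a b hab
            simp only [wt]
            rw [← Real.exp_add, Real.exp_le_exp]
            have := norm_sub_norm_le (pos b) (pos a)
            nlinarith
          have h2 := hnear i j (not_le.mp hf).le
          have h3 := hnear j i (by rw [norm_sub_rev]; exact (not_le.mp hf).le)
          rw [h0, add_zero, abs_le]
          constructor <;> nlinarith [mul_nonneg (hwt0 i).le hexp, mul_nonneg (hwt0 j).le hexp]
      calc ‖(wt i - wt j) * t i j‖ = |wt i - wt j| * |t i j| := by
            rw [norm_mul, Real.norm_eq_abs, Real.norm_eq_abs]
        _ ≤ ((wt i + wt j) * ((Real.exp (c * r) - 1) + far i j)) * |t i j| := by gcongr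
        _ = G (i, j) + G (i, j).swap := by
            simp only [G, Prod.swap_prod_mk, hfs, hts]
            ring
    have h1 := tsum_of_norm_bounded hG2 hbound
    rw [hdiff.tsum_eq, ← mul_add, norm_mul, Real.norm_of_nonneg hW.le, Real.norm_eq_abs,
      ← two_mul, abs_mul, abs_two] at h1
    have h2 : (∑' i, wt i) * |κ| ≤ (∑' i, wt i) * ((Real.exp (c * r) - 1) * M + ε) := by
      have h3 : ∑' x, G x ≤ (∑' i, wt i) * ((Real.exp (c * r) - 1) * M + ε) := hGle
      linarith
    exact le_of_mul_le_mul_left h2 hW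
  rw [← abs_nonpos_iff]
  refine le_of_forall_pos_le_add fun ε hε => ?_
  obtain ⟨r, hr⟩ := key ε hε
  have hlim : Tendsto (fun c : ℝ => (Real.exp (c * r) - 1) * M + ε) (𝓝[>] 0) (𝓝 (0 + ε)) := by
    have hc : Continuous fun c : ℝ => (Real.exp (c * r) - 1) * M + ε := by fun_prop
    exact (hc.tendsto' 0 _ (by simp)).mono_left nhdsWithin_le_nhds
  exact ge_of_tendsto hlim (eventually_mem_nhdsWithin.mono fun c hc => hr c hc)

/-! ### The norm of a tempered distribution -/

theorem toTemperedDistribution_injective :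
    Function.Injective fun f : L2 d => (f : 𝓢'(Space d, ℂ)) := by
  have h := LinearMap.ker_eq_bot.mp (Lp.ker_toTemperedDistributionCLM_eq_bot
    (E := Space d) (F := ℂ) (μ := volume) (p := 2))
  exact h

theorem exists_of_l2norm_ne_top {T : 𝓢'(Space d, ℂ)} (hT : l2norm T ≠ ⊤) :
    ∃ f : L2 d, (f : 𝓢'(Space d, ℂ)) = T := by
  by_contra! h
  exact hT (by simp [l2norm, h])

theorem l2norm_coe (f : L2 d) : l2norm (f : 𝓢'(Space d, ℂ)) = eLpNorm f 2 volume := by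
  refine le_antisymm
    (iInf₂_le (f := fun (f' : L2 d) (_ : (f' : 𝓢'(Space d, ℂ)) = f) => eLpNorm f' 2 volume) f rfl)
    (le_iInf₂ fun f' hf' => ?_)
  rw [toTemperedDistribution_injective hf']

/-- `Q_v` has no kernel in `L²(ℝ^d)` unless `v = 0`. -/
theorem eq_zero_of_Q_eq_zero {v : Phase d} (hv : v ≠ 0) {g : L2 d}
    (h : ((0 : L2 d) : 𝓢'(Space d, ℂ)) = Q v (g : 𝓢'(Space d, ℂ))) : g = 0 := by
  have hd : ∀ t, HasDerivAt (fun t => flow v t g) 0 t := fun t => by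
    simpa [flow] using hasDerivAt_flow h t
  have hconst : ∀ t, flow v t g = g := fun t => by
    rw [is_const_of_deriv_eq_zero (fun t => (hd t).differentiableAt) (fun t => (hd t).deriv) t 0,
      flow_zero]
  refine eq_zero_of_norm_inner_tf_eq (z := (v.2, -v.1)) (fun hz => hv ?_) g fun t f => ?_
  · rw [Prod.mk_eq_zero, neg_eq_zero] at hz
    exact Prod.ext hz.2 hz.1
  · conv_rhs =>
      rw [← hconst t, flow, inner_smul_left, norm_mul, RCLike.norm_conj, norm_chi, one_mul]
    simp [Prod.smul_mk]

theorem l2norm_Q_ne_zero {v : Phase d} (hv : v ≠ 0) {g : L2 d} (hg : g ≠ 0) :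
    l2norm (Q v (g : 𝓢'(Space d, ℂ))) ≠ 0 := by
  intro h0
  obtain ⟨f, hf⟩ := exists_of_l2norm_ne_top (T := Q v (g : 𝓢'(Space d, ℂ))) (by simp [h0])
  rw [← hf, l2norm_coe, eLpNorm_eq_zero_iff (Lp.aestronglyMeasurable f) (by norm_num),
    ← Lp.eq_zero_iff_ae_eq_zero] at h0
  rw [h0] at hf
  exact hg (eq_zero_of_Q_eq_zero hv hf)

theorem gauss_ne_zero : (gauss : L2 d) ≠ 0 := by
  intro h
  rw [Lp.eq_zero_iff_ae_eq_zero] at h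
  obtain ⟨x, h1, h2⟩ := (h.and gauss_ae).exists
  rw [h2] at h1
  exact Complex.exp_ne_zero _ h1

/-! ### The Balian-Low theorem -/

/-- If `g` generates an orthonormal basis and lies in the domains of `Q_v` and `Q_w`, then
`⟪Q_v g, Q_w g⟫` is real: the matrices of coefficients `⟪tf q g, tf p h⟫` and `⟪tf q g, tf p k⟫` are
Hermitian, so that the imaginary parts of the terms of Parseval's identity form an antisymmetric
kernel with constant row sums. -/
theorem im_inner_eq_zero {Λ : Set (Phase d)} {g : L2 d} (hg : IsGaborOrthonormalBasis Λ g)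
    [Nonempty Λ] {v w : Phase d} {h k : L2 d} (hv : HasGen v g h) (hw : HasGen w g k) :
    (⟪h, k⟫_ℂ).im = 0 := by
  obtain ⟨b, hb⟩ := hg
  have hb' : ∀ p : Λ, b p = tf (p : Phase d) g := hb
  have hon : Orthonormal ℂ fun p : Λ => tf (p : Phase d) g := by
    have := b.orthonormal
    rwa [show (b : Λ → L2 d) = fun p : Λ => tf (p : Phase d) g from funext hb'] at this
  have hg0 : g ≠ 0 := by
    rintro rfl
    have := hon.1 (Classical.arbitrary Λ)
    simp at this
  obtain ⟨δ, hδ, hsep⟩ := exists_sep_of_orthonormal hg0 hon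
  have hpq : ∀ p q : Λ, (p : Phase d) = q ∨ ⟪tf (p : Phase d) g, tf (q : Phase d) g⟫_ℂ = 0 := by
    intro p q
    by_cases hpq : p = q
    · exact .inl (congrArg Subtype.val hpq)
    · exact .inr (hon.2 hpq)
  let T : Λ → Λ → ℂ := fun p q => ⟪tf (p : Phase d) h, tf (q : Phase d) g⟫_ℂ *
    ⟪tf (q : Phase d) g, tf (p : Phase d) k⟫_ℂ
  have hT : ∀ p q, T q p = conj (T p q) := by
    intro p q
    simp only [T]
    rw [map_mul, inner_conj_symm, inner_conj_symm, ← hv.inner_tf_symm (hpq q p),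
      hw.inner_tf_symm (hpq p q)]
  have hTle : ∀ p q, |(T p q).im| ≤ ‖⟪tf (q : Phase d) g, tf (p : Phase d) h⟫_ℂ‖ ^ 2
      + ‖⟪tf (q : Phase d) g, tf (p : Phase d) k⟫_ℂ‖ ^ 2 := by
    intro p q
    refine (Complex.abs_im_le_norm _).trans ?_
    rw [norm_mul, norm_inner_symm]
    nlinarith [sq_nonneg (‖⟪tf (q : Phase d) g, tf (p : Phase d) h⟫_ℂ‖
      - ‖⟪tf (q : Phase d) g, tf (p : Phase d) k⟫_ℂ‖),
      sq_nonneg ‖⟪tf (q : Phase d) g, tf (p : Phase d) h⟫_ℂ‖,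
      sq_nonneg ‖⟪tf (q : Phase d) g, tf (p : Phase d) k⟫_ℂ‖]
  have hsum : ∀ p (P : Finset Λ), ∑ q ∈ P, |(T p q).im| ≤
      ∑ q ∈ P, ‖⟪tf (q : Phase d) g, tf (p : Phase d) h⟫_ℂ‖ ^ 2
        + ∑ q ∈ P, ‖⟪tf (q : Phase d) g, tf (p : Phase d) k⟫_ℂ‖ ^ 2 := by
    intro p P
    rw [← Finset.sum_add_distrib]
    exact Finset.sum_le_sum fun q _ => hTle p q
  refine eq_zero_of_antisymm_kernel (fun p : Λ => (p : Phase d)) (fun c hc => ?_)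
    (fun p q => (T p q).im) (M := ‖h‖ ^ 2 + ‖k‖ ^ 2) (fun p q => ?_) (fun p => ?_)
    (fun p P => ?_) (fun ε hε => ?_)
  · obtain ⟨M, -, hM⟩ := exists_sum_exp_neg_le (E := Phase d) hc hδ
    refine summable_of_sum_le (c := M) (fun _ => (Real.exp_pos _).le) fun P => ?_
    have h1 := hM (P.map (Function.Embedding.subtype (· ∈ Λ))) (hsep.mono fun p hp => by
      simp only [Finset.coe_map, Set.mem_image] at hp
      obtain ⟨p, -, rfl⟩ := hp
      exact p.2) 0
    simpa using h1
  · rw [hT, Complex.conj_im]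
  · have h1 := b.hasSum_inner_mul_inner (tf (p : Phase d) h) (tf (p : Phase d) k)
    simp only [hb', (tf (p : Phase d)).inner_map_map] at h1
    exact Complex.hasSum_im h1
  · refine (hsum p P).trans (add_le_add ?_ ?_)
    · rw [← (tf (p : Phase d)).norm_map h]
      exact hon.sum_inner_products_le _
    · rw [← (tf (p : Phase d)).norm_map k]
      exact hon.sum_inner_products_le _
  · obtain ⟨r, hr⟩ := tail_orthonormal hδ hsep hon h (ε / 2) (by positivity)
    obtain ⟨r', hr'⟩ := tail_orthonormal hδ hsep hon k (ε / 2) (by positivity)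
    refine ⟨max r r', fun p P hP => ?_⟩
    have h1 := hr p P fun q hq => (le_max_left _ _).trans (hP q hq)
    have h2 := hr' p P fun q hq => (le_max_right _ _).trans (hP q hq)
    linarith [hsum p P]

end Gabor
end

theorem theoremt12 (d : ℕ) (Λ : Set (Gabor.Phase d)) (hΛ : Λ.Countable)
    (hneg : ∀ p ∈ Λ, -p ∈ Λ) (g : Gabor.L2 d) (hg : Gabor.IsGaborOrthonormalBasis Λ g)
    (v w : Gabor.Phase d) (hvw : Gabor.symplecticForm v w ≠ 0) :
    Gabor.l2norm (Gabor.Q v g) * Gabor.l2norm (Gabor.Q w g) = ⊤ := by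
  have hv0 : v ≠ 0 := by
    rintro rfl
    simp [Gabor.symplecticForm] at hvw
  have hw0 : w ≠ 0 := by
    rintro rfl
    simp [Gabor.symplecticForm] at hvw
  have : Nonempty Λ := by
    by_contra hempty
    rw [not_nonempty_iff] at hempty
    obtain ⟨b, -⟩ := hg
    have h1 := (b.hasSum_inner_mul_inner Gabor.gauss Gabor.gauss).unique hasSum_empty
    exact Gabor.gauss_ne_zero (inner_self_eq_zero.mp h1)
  have hg0 : g ≠ 0 := by
    rintro rfl
    obtain ⟨b, hb⟩ := hg
    have h1 := b.orthonormal.1 (Classical.arbitrary Λ)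
    rw [hb, ← Gabor.tf_apply, map_zero, norm_zero] at h1
    exact zero_ne_one h1
  have hv1 := Gabor.l2norm_Q_ne_zero hv0 hg0
  have hw1 := Gabor.l2norm_Q_ne_zero hw0 hg0
  rw [ENNReal.mul_eq_top]
  by_contra! hcon
  obtain ⟨h, hh⟩ := Gabor.exists_of_l2norm_ne_top fun hv => hw1 (hcon.2 hv)
  obtain ⟨k, hk⟩ := Gabor.exists_of_l2norm_ne_top (hcon.1 hv1)
  have hgv := Gabor.hasGen_of_eq_Q hh
  have hgw := Gabor.hasGen_of_eq_Q hk
  have hcomm := hgv.commutator hgw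
  -- A real inner product is symmetric, so the commutator vanishes.
  have hreal : inner ℂ h k = inner ℂ k h := by
    rw [← inner_conj_symm k h]
    exact (Complex.conj_eq_iff_im.mpr (Gabor.im_inner_eq_zero hg hgv hgw)).symm
  rw [hreal, sub_self, mul_zero] at hcomm
  have hnorm : (‖g‖ : ℂ) ≠ 0 := by simpa using hg0
  exact mul_ne_zero (Complex.ofReal_ne_zero.mpr hvw) (pow_ne_zero 2 hnorm) hcomm.symm
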